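/- **Setting.** Processes with totally ordered identifiers communicate by asynchronous point-to-point messages and may crash. A finite set $\mathcal S$ of processes are the replicas. Tags are pairs $\langle z, p\rangle$ of a non-negative integer and a process identifier, ordered lexicographically; they serve as versions. Let $\tau_0$ be any initial tag and $v_0$ any initial value; initially every replica stores $\langle\tau_0,v_0\rangle$. Each process has at most one operation under way at a time, either $\mathrm{cvr\text{-}read}()$ or $\mathrm{cvr\text{-}write}(val,ver)$, where $ver$ is an arbitrary tag. **Algorithm vMWABD.** An operation has two phases. *Query phase:* the process sends a query to all replicas, waits until it has received the tag-value pairs of a majority of them, and selects among the pairs received one, $\langle\tau,v\rangle$, with the largest tag $\tau=\langle z,\cdot\rangle$. A $\mathrm{cvr\text{-}write}(val,ver)$ by $p$ with $ver=\tau$ sets $\langle\tau_{new},val_{new}\rangle=\langle\langle z+1,p\rangle,val\rangle$; a $\mathrm{cvr\text{-}write}(val,ver)$ with $ver\ne\tau$ and a $\mathrm{cvr\text{-}read}$ set $\langle\tau_{new},val_{new}\rangle=\langle\tau,v\rangle$. *Propagation phase:* the process sends $\langle\tau_{new},val_{new}\rangle$ to all replicas and waits for acks from a majority of them. A read then returns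 $(val_{new},\tau_{new})$; a write returns $(val_{new},\tau_{new},chg)$ if $ver=\tau$ and $(val_{new},\tau_{new},unchg)$ otherwise. *Replicas* answer a query with their stored pair; on receipt of a propagated pair they store it if its tag is larger than the stored tag, and reply with an ack. Replies are matched to the phase and operation they answer. **Histories.** The history of a (finite or infinite) execution is its sequence of invocations and responses; $\pi_1\to\pi_2$ means that the response of $\pi_1$ occurs before the invocation of $\pi_2$. A completion of a history consists of a set $\Pi$ of operations that contains all complete operations and possibly some incomplete ones, with a response for each operation in $\Pi$, which is the actual one if the operation is complete; an incomplete operation precedes ($\to$) no operation. The responses have the right form: a read returns a value and a version, a write returns a value, a version and a flag; a write with flag $chg$ returns the value it wrote, and a write with flag $unchg$ returns a version other than the requested one. $\mathcal W$ denotes the set of successful writes in $\Pi$, i.e. those with flag $chg$; $\omega[ver\to ver']\in\mathcal W$ means that the write $\omega$ requested version $ver$ and returned version $ver'$. Reads are the reads and the unsuccessful ($unchg$) writes in $\Pi$. $\mathit{Versions}$ is the set of versions returned by writes in $\mathcal W$, together with $\tau_0$. A chain with $m$ revisions from $a$ to $b$ is a sequence of versions $a=s_0,\dots,s_m=b$ such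 that for each $i<m$ some write in $\mathcal W$ is of the form $\omega[s_i\to s_{i+1}]$. **Theorem.** Algorithm vMWABD implements a weakly coverable atomic register: (i) *Safety.* For every execution there are a completion of its history and a strict partial order $\prec$ on $\Pi$ such that - **A1**: if $\pi_1\to\pi_2$ then not $\pi_2\prec\pi_1$; - **A2**: if $\pi\in\mathcal W$ and $\pi'\in\Pi$, $\pi'\neq\pi$, then $\pi\prec\pi'$ or $\pi'\prec\pi$; - **A3**: each read returns the value and version written by the last write of $\mathcal W$ that precedes it in $\prec$, or $v_0,\tau_0$ if there is none; - **Validity**: $ver<ver'$ for every $\omega[ver\to ver']\in\mathcal W$; distinct writes in $\mathcal W$ return distinct versions; for each version in $\mathit{Versions}$ there is a chain from $\tau_0$ to it; - **Consolidation**: if $\omega_1[*\to ver_i],\ \omega_2[ver_j\to *]\in\mathcal W$ and $\omega_1\to\omega_2$, then $ver_i\le ver_j$ and $\omega_1\prec\omega_2$; - **Continuity**: if $\omega_2[ver\to *]\in\mathcal W$, then $ver=\tau_0$ or there is $\omega_1[*\to ver]\in\mathcal W$ with $\omega_1\prec\omega_2$; - **Evolution**: if $ver,ver',ver''\in\mathit{Versions}$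 and there are chains from $ver$ to $ver'$ with $k$ revisions and from $ver$ to $ver''$ with $\ell$ revisions, where $k<\ell$, then $ver'<ver''$. In particular, if all operations of the execution are complete, this holds for the set $\Pi$ of all operations with their actual responses. (ii) *Termination.* In every fair execution (every message between processes that never crash is eventually delivered, and such processes eventually take their enabled local steps) in which a majority of the replicas never crash, every operation invoked by a process that never crashes completes. -/

import Mathlib

/-! ### Versioned registers: histories, atomicity, weak coverability -/

namespace VersionedRegister

/-- Requests on a versioned register: `cvr-read()` and `cvr-write(val, ver)`. -/
inductive Request (V Ver : Type*) where
  | read : Request V Ver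
  | write (val : V) (ver : Ver) : Request V Ver

/-- The flag returned by a write. -/
inductive Flag where
  | chg : Flag
  | unchg : Flag

/-- Responses: a read returns value and version; a write returns value, version and flag. -/
inductive Response (V Ver : Type*) where
  | read (val : V) (ver : Ver) : Response V Ver
  | write (val : V) (ver : Ver) (flag : Flag) : Response V Ver

/-- Invocation and response events at a process. -/
inductive Event (P V Ver : Type*) where
  | inv (p : P) (i : Request V Ver) : Event P V Ver
  | res (p : P) (r : Response V Ver) : Event P V Ver

/-- The process at which an event takes place. -/
def Event.proc {P V Ver : Type*} : Event P V Ver → P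
  | .inv p _ => p
  | .res p _ => p

/-- A history, indexed by the steps of an execution; `none` at the steps that are neither an
invocation nor a response. -/
abbrev History (P V Ver : Type*) := ℕ → Option (Event P V Ver)

variable {P V Ver : Type*}

/-- Operations are named by the step of their invocation: `Invokes H t p i` says that step `t`
is the invocation step of an operation with request `i` by process `p`. -/
def Invokes (H : History P V Ver) (t : ℕ) (p : P) (i : Request V Ver) : Prop :=
  H t = some (Event.inv p i)

/-- Step `t'` is the matching response step, with response `r`, of the operation invoked at
step `t`: the next event of the same process. -/
def RespondsAt (H : History P V Ver) (t t' : ℕ) (r : Response V Ver) : Prop :=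
  ∃ p i, Invokes H t p i ∧ t < t' ∧ H t' = some (Event.res p r) ∧
    ∀ u, t < u → u < t' → ∀ e, H u = some e → e.proc ≠ p

/-- The operation invoked at step `t` is complete. -/
def IsComplete (H : History P V Ver) (t : ℕ) : Prop :=
  ∃ t' r, RespondsAt H t t' r

/-- Real-time precedence `π₁ → π₂`: the response step of `π₁` appears before the invocation
step of `π₂`. -/
def Precedes (H : History P V Ver) (t₁ t₂ : ℕ) : Prop :=
  ∃ t' r, RespondsAt H t₁ t' r ∧ t' < t₂

/-- A completion of a history: a set `ops` of operations that contains all complete operations,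
and possibly some incomplete ones, with a response for each of them, which is the actual response
for complete operations. (Incomplete operations outside `ops` are dropped; those in `ops` get
their response after the end of the history and so precede no operation.) If all operations are
complete, `ops` is the set of all operations and `resp` gives their actual responses. -/
structure IsCompletion (H : History P V Ver) (ops : Set ℕ) (resp : ℕ → Response V Ver) :
    Prop where
  invoked : ∀ t ∈ ops, ∃ p i, Invokes H t p i
  complete : ∀ t t' r, RespondsAt H t t' r → t ∈ ops ∧ resp t = r

/-- The responses that the transitions of a versioned register admit for a request: a write that
changes the register returns the value it wrote, and a write that does not change it returns a
version different from the one it intended to overwrite. -/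
def Request.Admits : Request V Ver → Response V Ver → Prop
  | .read, .read _ _ => True
  | .write v _, .write v' _ .chg => v' = v
  | .write _ ver, .write _ ver' .unchg => ver' ≠ ver
  | _, _ => False

/-- Every operation in `ops` has a response of the right form. -/
def WellTyped (H : History P V Ver) (ops : Set ℕ) (resp : ℕ → Response V Ver) : Prop :=
  ∀ t ∈ ops, ∀ p i, Invokes H t p i → i.Admits (resp t)

/-- `t` is a successful write of value `v` that revises version `ver` to version `ver'`. -/
def SuccWriteVal (H : History P V Ver) (ops : Set ℕ) (resp : ℕ → Response V Ver)
    (t : ℕ) (v : V) (ver ver' : Ver) : Prop :=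
  t ∈ ops ∧ (∃ p, Invokes H t p (Request.write v ver)) ∧ resp t = Response.write v ver' Flag.chg

/-- `t` is a successful write that revises version `ver` to version `ver'`. -/
def SuccWrite (H : History P V Ver) (ops : Set ℕ) (resp : ℕ → Response V Ver)
    (t : ℕ) (ver ver' : Ver) : Prop :=
  ∃ v, SuccWriteVal H ops resp t v ver ver'

/-- `t` is a successful write. -/
def IsWrite (H : History P V Ver) (ops : Set ℕ) (resp : ℕ → Response V Ver) (t : ℕ) : Prop :=
  ∃ ver ver', SuccWrite H ops resp t ver ver'

/-- `t` is a read, or an unsuccessful write, that returns value `v` and version `ver`. -/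
def ReadReturns (ops : Set ℕ) (resp : ℕ → Response V Ver) (t : ℕ) (v : V) (ver : Ver) : Prop :=
  t ∈ ops ∧ (resp t = Response.read v ver ∨ resp t = Response.write v ver Flag.unchg)

/-- Atomicity with respect to the partial order `lt` on the operations `ops`. In `A2` and `A3` a
write is a successful write, and a read is a read or an unsuccessful write. -/
structure IsAtomic (ver₀ : Ver) (v₀ : V) (H : History P V Ver) (ops : Set ℕ)
    (resp : ℕ → Response V Ver) (lt : ℕ → ℕ → Prop) : Prop where
  irrefl : ∀ a ∈ ops, ¬ lt a a
  trans : ∀ a ∈ ops, ∀ b ∈ ops, ∀ c ∈ ops, lt a b → lt b c → lt a c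
  A1 : ∀ a ∈ ops, ∀ b ∈ ops, Precedes H a b → ¬ lt b a
  A2 : ∀ a ∈ ops, ∀ b ∈ ops, IsWrite H ops resp a → a ≠ b → lt a b ∨ lt b a
  A3 : ∀ t v ver, ReadReturns ops resp t v ver →
    (∃ w ver', SuccWriteVal H ops resp w v ver' ver ∧ lt w t ∧
      ∀ w', IsWrite H ops resp w' → lt w' t → w' = w ∨ lt w' w) ∨
    ((∀ w, IsWrite H ops resp w → ¬ lt w t) ∧ v = v₀ ∧ ver = ver₀)

/-- The set of versions produced by successful writes, together with the initial version. -/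
def Versions (ver₀ : Ver) (H : History P V Ver) (ops : Set ℕ) (resp : ℕ → Response V Ver) :
    Set Ver :=
  {ver | ver = ver₀ ∨ ∃ t ver', SuccWrite H ops resp t ver' ver}

/-- There is a sequence of versions from `a` to `b` with `m` revisions by successful writes. -/
def RevisionChain (H : History P V Ver) (ops : Set ℕ) (resp : ℕ → Response V Ver)
    (m : ℕ) (a b : Ver) : Prop :=
  ∃ s : ℕ → Ver, s 0 = a ∧ s m = b ∧ ∀ i < m, ∃ t, SuccWrite H ops resp t (s i) (s (i + 1))

/-- Validity. -/
structure IsValid [LinearOrder Ver] (ver₀ : Ver) (H : History P V Ver) (ops : Set ℕ)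
    (resp : ℕ → Response V Ver) : Prop where
  increasing : ∀ t ver ver', SuccWrite H ops resp t ver ver' → ver < ver'
  unique : ∀ t₁ t₂ a b ver' ver'', t₁ ≠ t₂ → SuccWrite H ops resp t₁ a ver' →
    SuccWrite H ops resp t₂ b ver'' → ver' ≠ ver''
  derived : ∀ ver ∈ Versions ver₀ H ops resp, ∃ k, RevisionChain H ops resp k ver₀ ver

/-- Weak coverability with respect to the order `lt` on the successful writes. -/
structure IsWeaklyCoverable [LinearOrder Ver] (ver₀ : Ver) (H : History P V Ver) (ops : Set ℕ)
    (resp : ℕ → Response V Ver) (lt : ℕ → ℕ → Prop) : Prop where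
  consolidation : ∀ t₁ t₂ a verᵢ verⱼ b, SuccWrite H ops resp t₁ a verᵢ →
    SuccWrite H ops resp t₂ verⱼ b → Precedes H t₁ t₂ → verᵢ ≤ verⱼ ∧ lt t₁ t₂
  continuity : ∀ t₂ ver verᵢ, SuccWrite H ops resp t₂ ver verᵢ →
    (∃ t₁ a, SuccWrite H ops resp t₁ a ver ∧ lt t₁ t₂) ∨ ver = ver₀
  evolution : ∀ ver ∈ Versions ver₀ H ops resp, ∀ ver' ∈ Versions ver₀ H ops resp,
    ∀ ver'' ∈ Versions ver₀ H ops resp, ∀ k l, RevisionChain H ops resp k ver ver' →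
    RevisionChain H ops resp l ver ver'' → k < l → ver' < ver''

/-- A history is that of a weakly coverable atomic register with initial version `ver₀` and
initial value `v₀` if it has a completion that is valid, atomic and weakly coverable with respect
to one and the same order. -/
def IsWeaklyCoverableAtomic [LinearOrder Ver] (ver₀ : Ver) (v₀ : V) (H : History P V Ver) :
    Prop :=
  ∃ (ops : Set ℕ) (resp : ℕ → Response V Ver) (lt : ℕ → ℕ → Prop),
    IsCompletion H ops resp ∧ WellTyped H ops resp ∧
    IsAtomic ver₀ v₀ H ops resp lt ∧
    IsValid ver₀ H ops resp ∧
    IsWeaklyCoverable ver₀ H ops resp lt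

end VersionedRegister

/-! ### The algorithm as a transition system -/

namespace VMWABD

open VersionedRegister

/-- Tags: an integer and a writer identifier, ordered lexicographically. -/
abbrev Tag (P : Type*) := ℕ ×ₗ P

/-- Contents of messages. -/
inductive Body (P V : Type*) where
  | query : Body P V
  | queryReply (pair : Tag P × V) : Body P V
  | propagate (pair : Tag P × V) : Body P V
  | ack : Body P V

/-- A message; `seq` is the number of the sender's (for requests) or the addressee's (for
replies) operation to which it belongs. -/
structure Msg (P V : Type*) where
  src : P
  dst : P
  seq : ℕ
  body : Body P V

/-- What a process is doing as a client: nothing; the query phase of an operation, with the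
replies received so far; or its propagation phase, with the largest tag `τ` found in the query
phase, the pair being propagated and the set of replicas from which an ack was received. -/
inductive Phase (P V : Type*) where
  | idle : Phase P V
  | query (req : Request V (Tag P)) (replies : P → Option (Tag P × V)) : Phase P V
  | propagation (req : Request V (Tag P)) (τ : Tag P) (pair : Tag P × V) (acks : Finset P) :
      Phase P V

/-- State of a process; `pair` is the tag-value pair that it stores as a replica, and `seq` the
number of operations it has invoked. -/
structure ProcState (P V : Type*) where
  crashed : Prop
  seq : ℕ
  phase : Phase P V
  pair : Tag P × V

/-- Global state: the processes and the messages in transit. -/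
structure State (P V : Type*) where
  proc : P → ProcState P V
  net : Multiset (Msg P V)

/-- Actions of the system. -/
inductive Action (P V : Type*) where
  | invoke (p : P) (req : Request V (Tag P)) : Action P V
  | endQuery (p : P) : Action P V
  | respond (p : P) (r : Response V (Tag P)) : Action P V
  | deliver (m : Msg P V) : Action P V
  | crash (p : P) : Action P V

variable {P V : Type*}

/-- Initially all replicas hold the initial tag and value and nothing is under way. -/
def initial (τ₀ : Tag P) (v₀ : V) : State P V where
  proc := fun _ => { crashed := False, seq := 0, phase := .idle, pair := (τ₀, v₀) }
  net := 0

/-- The messages with the given body from `p` to all the replicas. -/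
def broadcast (S : Finset P) (p : P) (seq : ℕ) (body : Body P V) : Multiset (Msg P V) :=
  S.val.map fun r => { src := p, dst := r, seq := seq, body := body }

/-- `Q` contains a majority of the replicas `S`. -/
def IsMajority (S : Finset P) (Q : Set P) : Prop :=
  S.card < 2 * ((S : Set P) ∩ Q).ncard

/-- `(τ, v)` is a pair with the largest tag among the replies. -/
def IsMaxReply [LinearOrder P] (S : Finset P) (replies : P → Option (Tag P × V))
    (τ : Tag P) (v : V) : Prop :=
  (∃ r ∈ S, replies r = some (τ, v)) ∧
    ∀ r ∈ S, ∀ τ' v', replies r = some (τ', v') → τ' ≤ τ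

/-- The pair that `p` propagates after finding `(τ, v)` in its query phase. -/
def newPair [LinearOrder P] (p : P) (req : Request V (Tag P)) (τ : Tag P) (v : V) : Tag P × V :=
  match req with
  | .read => (τ, v)
  | .write val ver => if ver = τ then (toLex ((ofLex τ).1 + 1, p), val) else (τ, v)

/-- The response to a request after `τ` was found in the query phase and `pair` propagated. -/
def response [LinearOrder P] (req : Request V (Tag P)) (τ : Tag P) (pair : Tag P × V) :
    Response V (Tag P) :=
  match req with
  | .read => .read pair.2 pair.1
  | .write _ ver => .write pair.2 pair.1 (if ver = τ then .chg else .unchg)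

/-- Handling of a received message: the new state of the addressee and the messages it sends.
Replies that do not belong to the current phase of the current operation are ignored. -/
def receive [LinearOrder P] (st : ProcState P V) (m : Msg P V) :
    ProcState P V × Multiset (Msg P V) :=
  match m.body with
  | .query => (st, {{ src := m.dst, dst := m.src, seq := m.seq, body := .queryReply st.pair }})
  | .propagate pair =>
      ({ st with pair := if st.pair.1 < pair.1 then pair else st.pair },
        {{ src := m.dst, dst := m.src, seq := m.seq, body := .ack }})
  | .queryReply pair =>
      match st.phase with
      | .query req replies =>
          if m.seq = st.seq then
            ({ st with phase := .query req (Function.update replies m.src (some pair)) }, 0)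
          else (st, 0)
      | _ => (st, 0)
  | .ack =>
      match st.phase with
      | .propagation req τ pair acks =>
          if m.seq = st.seq then
            ({ st with phase := .propagation req τ pair (insert m.src acks) }, 0)
          else (st, 0)
      | _ => (st, 0)

/-- The steps of the algorithm with set of replicas `S`. A process takes steps only as long as it
has not crashed, and invokes an operation only when it has no operation under way. The requested
version of a write is arbitrary. -/
inductive Step [LinearOrder P] (S : Finset P) : State P V → Action P V → State P V → Prop where
  | invoke (s : State P V) (p : P) (req : Request V (Tag P))
      (alive : ¬ (s.proc p).crashed) (idle : (s.proc p).phase = .idle) :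
      Step S s (.invoke p req)
        { proc := Function.update s.proc p
            { s.proc p with seq := (s.proc p).seq + 1, phase := .query req fun _ => none }
          net := s.net + broadcast S p ((s.proc p).seq + 1) .query }
  | endQuery (s : State P V) (p : P) (req : Request V (Tag P))
      (replies : P → Option (Tag P × V)) (τ : Tag P) (v : V)
      (alive : ¬ (s.proc p).crashed) (phase : (s.proc p).phase = .query req replies)
      (majority : IsMajority S {r | replies r ≠ none}) (max : IsMaxReply S replies τ v) :
      Step S s (.endQuery p)
        { proc := Function.update s.proc p
            { s.proc p with phase := .propagation req τ (newPair p req τ v) ∅ }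
          net := s.net + broadcast S p (s.proc p).seq (.propagate (newPair p req τ v)) }
  | respond (s : State P V) (p : P) (req : Request V (Tag P)) (τ : Tag P) (pair : Tag P × V)
      (acks : Finset P)
      (alive : ¬ (s.proc p).crashed) (phase : (s.proc p).phase = .propagation req τ pair acks)
      (majority : IsMajority S (acks : Set P)) :
      Step S s (.respond p (response req τ pair))
        { s with proc := Function.update s.proc p { s.proc p with phase := .idle } }
  | deliver (s : State P V) (m : Msg P V) (rest : Multiset (Msg P V))
      (transit : s.net = m ::ₘ rest) (alive : ¬ (s.proc m.dst).crashed) :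
      Step S s (.deliver m)
        { proc := Function.update s.proc m.dst (receive (s.proc m.dst) m).1
          net := rest + (receive (s.proc m.dst) m).2 }
  | crash (s : State P V) (p : P) :
      Step S s (.crash p)
        { s with proc := Function.update s.proc p { s.proc p with crashed := True } }

/-- Executions from the initial state. `act t = none` means that nothing happens at time `t`, so
finite executions are those in which nothing happens from some time on. -/
structure Execution [LinearOrder P] (S : Finset P) (τ₀ : Tag P) (v₀ : V) where
  state : ℕ → State P V
  act : ℕ → Option (Action P V)
  init : state 0 = initial τ₀ v₀
  idle : ∀ t, act t = none → state (t + 1) = state t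
  step : ∀ t a, act t = some a → Step S (state t) a (state (t + 1))

/-- The event of the register's interface in an action. -/
def Action.event : Action P V → Option (Event P V (Tag P))
  | .invoke p req => some (.inv p req)
  | .respond p r => some (.res p r)
  | _ => none

variable [LinearOrder P] {S : Finset P} {τ₀ : Tag P} {v₀ : V}

/-- The history of an execution. -/
def Execution.history (ξ : Execution S τ₀ v₀) : History P V (Tag P) :=
  fun t => (ξ.act t).bind Action.event

/-- Process `p` never crashes. -/
def Execution.Correct (ξ : Execution S τ₀ v₀) (p : P) : Prop :=
  ∀ t, ξ.act t ≠ some (.crash p)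

/-- The action `a` is a local step by which `p` ends a phase of its operation. -/
def Action.IsLocal (p : P) (a : Action P V) : Prop :=
  a = .endQuery p ∨ ∃ r, a = .respond p r

/-- Fairness. Channels between correct processes are reliable: no message stays in transit
forever. A correct process takes a local step unless none is enabled. (Nothing is required of the
messages of a crashed process, so a crash in the middle of a broadcast is accounted for.) -/
structure Execution.Fair (ξ : Execution S τ₀ v₀) : Prop where
  deliver : ∀ m : Msg P V, ξ.Correct m.src → ξ.Correct m.dst →
    ∀ t, m ∈ (ξ.state t).net → ∃ t' ≥ t, ξ.act t' = some (.deliver m)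
  localStep : ∀ p, ξ.Correct p → ∀ t, ∃ t' ≥ t,
    (∃ a, a.IsLocal p ∧ ξ.act t' = some a) ∨ ¬ ∃ a s', a.IsLocal p ∧ Step S (ξ.state t') a s'

end VMWABD

/-! Safety rests on quorum intersection. The tag stored by a replica never decreases, and an
operation responds only after a majority of the replicas have acked its pair, hence store its tag or
a larger one (`AckInvariant`). The query quorum of any operation invoked after the response meets
that majority, so this later operation finds a tag at least as large
(`Execution.Proposes.le_of_precedes`). Sequence numbers make sure that stale messages of earlier
operations play no part in this.

A write succeeds exactly when the tag found is the requested version, and only then is a new pair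
created: the integer goes up by one and the identifier is the writer's own. All other pairs are
copies, so every pair in circulation is the initial one or that of a successful write
(`Execution.pairInvariant`). Two successful writes with the same tag are by the same process; its
operations are sequential, and the later one finds the tag of the earlier and exceeds it. So tags
identify successful writes (`Execution.Proposes.write_unique`), although several of them may revise
the same version.

The completion keeps the operations that have ended their query phase: their outcome is fixed from
then on, and the pair may be read by others even if the operation never responds. They are ordered
by returned version, a successful write coming before the reads of its version. Atomicity and
consolidation follow from the quorum argument and the uniqueness of tags; continuity and chains from
`τ₀`, because a version found has been written; evolution, because the integer of a tag counts
revisions.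

For termination, a correct process that is stuck in a phase eventually receives the replies of all
correct replicas. These are a majority, so from some time on the step that ends the phase is enabled
forever, and fairness forces it. -/

namespace VMWABD

open VersionedRegister

/-! ### Effect of a single step on clients, replicas and channels -/

section Steps

variable {P V : Type*} [LinearOrder P] {S : Finset P} {s s' : State P V} {a : Action P V}

/-- The process to whose operation a message belongs. -/
def Msg.client {P V : Type*} (m : Msg P V) : P :=
  match m.body with
  | .query => m.src
  | .propagate _ => m.src
  | .queryReply _ => m.dst
  | .ack => m.dst

/-- What a step does to the client side of process `p`. -/
inductive ClientStep (S : Finset P) (s s' : State P V) (a : Action P V) (p : P) : Prop where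
  | same (noEvent : ∀ e, a.event = some e → e.proc ≠ p)
      (seq_eq : (s'.proc p).seq = (s.proc p).seq)
      (phase_eq : (s'.proc p).phase = (s.proc p).phase) : ClientStep S s s' a p
  | invoke (req : Request V (Tag P)) (act_eq : a = .invoke p req)
      (phase : (s.proc p).phase = .idle)
      (seq_eq : (s'.proc p).seq = (s.proc p).seq + 1)
      (phase_eq : (s'.proc p).phase = .query req fun _ => none) : ClientStep S s s' a p
  | endQuery (req : Request V (Tag P)) (replies : P → Option (Tag P × V)) (τ : Tag P) (v : V)
      (act_eq : a = .endQuery p)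
      (phase : (s.proc p).phase = .query req replies)
      (majority : IsMajority S {r | replies r ≠ none}) (max : IsMaxReply S replies τ v)
      (seq_eq : (s'.proc p).seq = (s.proc p).seq)
      (phase_eq : (s'.proc p).phase = .propagation req τ (newPair p req τ v) ∅) :
      ClientStep S s s' a p
  | respond (req : Request V (Tag P)) (τ : Tag P) (pair : Tag P × V) (acks : Finset P)
      (act_eq : a = .respond p (response req τ pair))
      (phase : (s.proc p).phase = .propagation req τ pair acks)
      (majority : IsMajority S (acks : Set P))
      (seq_eq : (s'.proc p).seq = (s.proc p).seq)
      (phase_eq : (s'.proc p).phase = .idle) : ClientStep S s s' a p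
  | reply (req : Request V (Tag P)) (replies : P → Option (Tag P × V)) (r : P) (pair : Tag P × V)
      (act_eq : a = .deliver ⟨r, p, (s.proc p).seq, .queryReply pair⟩)
      (transit : ⟨r, p, (s.proc p).seq, .queryReply pair⟩ ∈ s.net)
      (phase : (s.proc p).phase = .query req replies)
      (seq_eq : (s'.proc p).seq = (s.proc p).seq)
      (phase_eq : (s'.proc p).phase = .query req (Function.update replies r (some pair))) :
      ClientStep S s s' a p
  | ack (req : Request V (Tag P)) (τ : Tag P) (pair : Tag P × V) (acks : Finset P) (r : P)
      (act_eq : a = .deliver ⟨r, p, (s.proc p).seq, .ack⟩)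
      (transit : ⟨r, p, (s.proc p).seq, .ack⟩ ∈ s.net)
      (phase : (s.proc p).phase = .propagation req τ pair acks)
      (seq_eq : (s'.proc p).seq = (s.proc p).seq)
      (phase_eq : (s'.proc p).phase = .propagation req τ pair (insert r acks)) :
      ClientStep S s s' a p

/-- All later invariants are checked along this case distinction, which hides stale replies, the
replica side and crashes in the case `same`. -/
theorem Step.clientStep (h : Step S s a s') (p : P) : ClientStep S s s' a p := by
  cases h with
  | invoke q req alive idle =>
    by_cases hq : q = p
    · subst hq
      exact .invoke req rfl idle (by simp) (by simp)
    · refine .same ?_ ?_ ?_ <;>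
        simp [Function.update_of_ne (Ne.symm hq), Action.event, Event.proc, hq]
  | endQuery q req replies τ v alive phase majority max =>
    by_cases hq : q = p
    · subst hq
      exact .endQuery req replies τ v rfl phase majority max (by simp) (by simp)
    · refine .same ?_ ?_ ?_ <;> simp [Function.update_of_ne (Ne.symm hq), Action.event]
  | respond q req τ pair acks alive phase majority =>
    by_cases hq : q = p
    · subst hq
      exact .respond req τ pair acks rfl phase majority (by simp) (by simp)
    · refine .same ?_ ?_ ?_ <;>
        simp [Function.update_of_ne (Ne.symm hq), Action.event, Event.proc, hq]
  | deliver m rest transit alive =>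
    have hm : m ∈ s.net := by simp [transit]
    obtain ⟨src, dst, seq, body⟩ := m
    by_cases hq : dst = p
    · subst hq
      cases body with
      | query => refine .same ?_ ?_ ?_ <;> simp [receive, Action.event]
      | propagate pair => refine .same ?_ ?_ ?_ <;> simp [receive, Action.event]
      | queryReply pair =>
        rcases hph : (s.proc dst).phase with _ | ⟨req, replies⟩ | ⟨req, τ, π, acks⟩
        · refine .same ?_ ?_ ?_ <;> simp [receive, Action.event, hph]
        · by_cases hs : seq = (s.proc dst).seq
          · subst hs
            refine .reply req replies src pair rfl hm hph ?_ ?_ <;> simp [receive, hph]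
          · refine .same ?_ ?_ ?_ <;> simp [receive, Action.event, hph, hs]
        · refine .same ?_ ?_ ?_ <;> simp [receive, Action.event, hph]
      | ack =>
        rcases hph : (s.proc dst).phase with _ | ⟨req, replies⟩ | ⟨req, τ, π, acks⟩
        · refine .same ?_ ?_ ?_ <;> simp [receive, Action.event, hph]
        · refine .same ?_ ?_ ?_ <;> simp [receive, Action.event, hph]
        · by_cases hs : seq = (s.proc dst).seq
          · subst hs
            refine .ack req τ π acks src rfl hm hph ?_ ?_ <;> simp [receive, hph]
          · refine .same ?_ ?_ ?_ <;> simp [receive, Action.event, hph, hs]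
    · refine .same ?_ ?_ ?_ <;> simp [Function.update_of_ne (Ne.symm hq), Action.event]
  | crash q =>
    by_cases hq : q = p
    · subst hq
      refine .same ?_ ?_ ?_ <;> simp [Action.event]
    · refine .same ?_ ?_ ?_ <;> simp [Function.update_of_ne (Ne.symm hq), Action.event]

theorem receive_pair (st : ProcState P V) (m : Msg P V) :
    (receive st m).1.pair = st.pair ∨
      ∃ pair, m.body = .propagate pair ∧ st.pair.1 < pair.1 ∧ (receive st m).1.pair = pair := by
  obtain ⟨src, dst, seq, body⟩ := m
  cases body with
  | query => left; rfl
  | propagate pair =>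
    by_cases h : st.pair.1 < pair.1
    · exact .inr ⟨pair, rfl, h, by simp [receive, h]⟩
    · exact .inl (by simp [receive, h])
  | queryReply pair => left; simp only [receive]; split <;> (try split) <;> rfl
  | ack => left; simp only [receive]; split <;> (try split) <;> rfl

/-- The stored pair of a process changes only to a propagated one with a larger tag. -/
theorem Step.pair_cases (h : Step S s a s') (r : P) :
    (s'.proc r).pair = (s.proc r).pair ∨
      ∃ p n pair, ⟨p, r, n, .propagate pair⟩ ∈ s.net ∧ (s.proc r).pair.1 < pair.1 ∧
        (s'.proc r).pair = pair := by
  cases h with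
  | invoke q => left; by_cases hq : r = q <;> [subst hq; skip] <;> simp [*]
  | endQuery q => left; by_cases hq : r = q <;> [subst hq; skip] <;> simp [*]
  | respond q => left; by_cases hq : r = q <;> [subst hq; skip] <;> simp [*]
  | crash q => left; by_cases hq : r = q <;> [subst hq; skip] <;> simp [*]
  | deliver m rest transit alive =>
    by_cases hq : r = m.dst
    · subst hq
      have hm : m ∈ s.net := by simp [transit]
      rcases receive_pair (s.proc m.dst) m with h | ⟨pair, hb, hlt, h⟩
      · left; simpa using h
      · refine .inr ⟨m.src, m.seq, pair, ?_, hlt, by simpa using h⟩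
        rw [← hb]; exact hm
    · left; simp [hq]

theorem Step.pair_mono (h : Step S s a s') (r : P) :
    (s.proc r).pair.1 ≤ (s'.proc r).pair.1 := by
  rcases h.pair_cases r with h | ⟨_, _, _, _, hlt, h⟩
  · rw [h]
  · rw [h]; exact hlt.le

/-- The messages that may be in transit after a step. -/
inductive Transit (s s' : State P V) : Msg P V → Prop where
  | old (m : Msg P V) (mem : m ∈ s.net) : Transit s s' m
  | query (p r : P) : Transit s s' ⟨p, r, (s'.proc p).seq, .query⟩
  | propagate (p r : P) (req : Request V (Tag P)) (τ : Tag P) (pair : Tag P × V)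
      (phase : (s'.proc p).phase = .propagation req τ pair ∅) :
      Transit s s' ⟨p, r, (s'.proc p).seq, .propagate pair⟩
  | reply (p r : P) (n : ℕ) (mem : ⟨p, r, n, .query⟩ ∈ s.net) :
      Transit s s' ⟨r, p, n, .queryReply (s.proc r).pair⟩
  | ack (p r : P) (n : ℕ) (pair : Tag P × V) (mem : ⟨p, r, n, .propagate pair⟩ ∈ s.net)
      (le : pair.1 ≤ (s'.proc r).pair.1) : Transit s s' ⟨r, p, n, .ack⟩

/-- Only an over-approximation of the channels is needed for the invariants. A new ack is compared
with the state after the step, in which the replica has already processed the pair. -/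
theorem Step.transit (h : Step S s a s') {m : Msg P V} (hm : m ∈ s'.net) : Transit s s' m := by
  cases h with
  | invoke q req =>
    rcases Multiset.mem_add.1 hm with hm | hm
    · exact .old m hm
    · obtain ⟨r, -, rfl⟩ := Multiset.mem_map.1 hm
      simpa using Transit.query (s := s) (s' := ⟨Function.update s.proc q
            { s.proc q with seq := (s.proc q).seq + 1, phase := .query req fun _ => none },
          s.net + broadcast S q ((s.proc q).seq + 1) .query⟩) q r
  | endQuery q req replies τ v =>
    rcases Multiset.mem_add.1 hm with hm | hm
    · exact .old m hm
    · obtain ⟨r, -, rfl⟩ := Multiset.mem_map.1 hm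
      simpa using Transit.propagate (s := s) (s' := ⟨Function.update s.proc q
            { s.proc q with phase := .propagation req τ (newPair q req τ v) ∅ },
          s.net + broadcast S q (s.proc q).seq (.propagate (newPair q req τ v))⟩) q r req τ
            (newPair q req τ v) (by simp)
  | respond => exact .old m hm
  | crash => exact .old m hm
  | deliver m' rest transit alive =>
    have hm' : m' ∈ s.net := by simp [transit]
    rcases Multiset.mem_add.1 hm with hm | hm
    · exact .old m (by simp [transit, hm])
    · obtain ⟨src, dst, seq, body⟩ := m'
      cases body with
      | query =>
        simp only [receive, Multiset.mem_singleton] at hm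
        subst hm
        exact .reply src dst seq hm'
      | propagate pair =>
        simp only [receive, Multiset.mem_singleton] at hm
        subst hm
        refine .ack src dst seq pair hm' ?_
        simp only [Function.update_self, receive]
        split
        · exact le_rfl
        · exact not_lt.1 ‹_›
      | queryReply pair =>
        simp only [receive] at hm
        split at hm <;> (try split at hm) <;> simp at hm
      | ack =>
        simp only [receive] at hm
        split at hm <;> (try split at hm) <;> simp at hm

theorem Step.seq_mono (h : Step S s a s') (p : P) : (s.proc p).seq ≤ (s'.proc p).seq := by
  rcases h.clientStep p <;> omega

end Steps

/-! ### Majorities of replicas intersect -/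

section Majorities

variable {P : Type*} {S : Finset P}

theorem IsMajority.mono {Q Q' : Set P} (h : IsMajority S Q) (hQ : ∀ r ∈ S, r ∈ Q → r ∈ Q') :
    IsMajority S Q' := by
  refine lt_of_lt_of_le h (Nat.mul_le_mul_left 2 (Set.ncard_le_ncard ?_ ?_))
  · exact fun r hr => ⟨hr.1, hQ r hr.1 hr.2⟩
  · exact S.finite_toSet.inter_of_left _

/-- Were the two traces on `S` disjoint, their union would have more than `S.card` elements. The
common member is found among the replicas themselves. -/
theorem IsMajority.exists_mem_inter {Q Q' : Set P} (h : IsMajority S Q) (h' : IsMajority S Q') :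
    ∃ r ∈ S, r ∈ Q ∧ r ∈ Q' := by
  by_contra! hne
  have hdisj : Disjoint ((S : Set P) ∩ Q) ((S : Set P) ∩ Q') :=
    Set.disjoint_left.2 fun r hr hr' => hne r hr.1 hr.2 hr'.2
  have hunion := Set.ncard_union_eq hdisj (S.finite_toSet.inter_of_left _)
    (S.finite_toSet.inter_of_left _)
  have hle : (((S : Set P) ∩ Q) ∪ ((S : Set P) ∩ Q')).ncard ≤ (S : Set P).ncard :=
    Set.ncard_le_ncard (Set.union_subset Set.inter_subset_left Set.inter_subset_left)
      S.finite_toSet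
  rw [Set.ncard_coe_finset] at hle
  unfold IsMajority at h h'
  omega

theorem IsMajority.exists_mem {Q : Set P} (h : IsMajority S Q) : ∃ r ∈ S, r ∈ Q := by
  obtain ⟨r, hr, hQ, -⟩ := h.exists_mem_inter h
  exact ⟨r, hr, hQ⟩

end Majorities

/-! ### Acks certify stored tags -/

section Invariant

variable {P V : Type*} [LinearOrder P] {S : Finset P}

/-- Acks in transit or received certify that their senders store a tag at least as large as the
one being propagated. -/
structure AckInvariant (s : State P V) : Prop where
  seq_le : ∀ m ∈ s.net, m.seq ≤ (s.proc m.client).seq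
  query : ∀ p req replies, (s.proc p).phase = .query req replies → ∀ r,
    (∀ pair, ⟨p, r, (s.proc p).seq, .propagate pair⟩ ∉ s.net) ∧
      ⟨r, p, (s.proc p).seq, .ack⟩ ∉ s.net
  propagate : ∀ p req τ pair acks, (s.proc p).phase = .propagation req τ pair acks →
    ∀ r pair', ⟨p, r, (s.proc p).seq, .propagate pair'⟩ ∈ s.net → pair' = pair
  transit : ∀ p req τ pair acks, (s.proc p).phase = .propagation req τ pair acks →
    ∀ r, ⟨r, p, (s.proc p).seq, .ack⟩ ∈ s.net → pair.1 ≤ (s.proc r).pair.1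
  acked : ∀ p req τ pair acks, (s.proc p).phase = .propagation req τ pair acks →
    ∀ r ∈ acks, pair.1 ≤ (s.proc r).pair.1

theorem Step.message_seq_le {s s' : State P V} {a : Action P V} (h : Step S s a s')
    (hs : ∀ m ∈ s.net, m.seq ≤ (s.proc m.client).seq) :
    ∀ m ∈ s'.net, m.seq ≤ (s'.proc m.client).seq := by
  intro m hm
  cases h.transit hm with
  | old _ hm => exact (hs m hm).trans (h.seq_mono _)
  | query p r => exact le_rfl
  | propagate p r => exact le_rfl
  | reply p r n hm' => exact (hs _ hm').trans (h.seq_mono p)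
  | ack p r n pair hm' => exact (hs _ hm').trans (h.seq_mono p)

/-- Numbers of messages never exceed the number of their client's current operation, so an
invocation starts with a fresh number. Hence no propagation or ack with the current number exists
during the query phase, and all those seen in the propagation phase belong to the one pair being
propagated. -/
theorem AckInvariant.step {s s' : State P V} {a : Action P V} (hs : AckInvariant s)
    (h : Step S s a s') : AckInvariant s' where
  seq_le := h.message_seq_le hs.seq_le
  query := by
    intro p req replies hph r
    -- Both kinds of message are excluded together, since a new ack answers an old propagation with
    -- the same client and number.
    have key : ∀ m ∈ s'.net, m.client = p → m.seq = (s'.proc p).seq →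
        (∃ r pair, m = ⟨p, r, (s'.proc p).seq, .propagate pair⟩) ∨
        (∃ r, m = ⟨r, p, (s'.proc p).seq, .ack⟩) → False := by
      intro m hm hc hseq hbody
      have hold : ∀ m ∈ s.net, m.client = p → m.seq = (s'.proc p).seq →
        (∃ r pair, m = ⟨p, r, (s'.proc p).seq, .propagate pair⟩) ∨
        (∃ r, m = ⟨r, p, (s'.proc p).seq, .ack⟩) → False := by
        intro m hm hc hseq hbody
        have hle := hs.seq_le m hm
        rw [hc, hseq] at hle
        have hq := hs.query p
        rcases h.clientStep p with ⟨_, hsq, hpe⟩ | ⟨_, _, _, hsq, hpe⟩ |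
          ⟨_, _, _, _, _, _, _, _, hsq, hpe⟩ | ⟨_, _, _, _, _, _, _, hsq, hpe⟩ |
          ⟨_, _, _, _, _, _, hph0, hsq, hpe⟩ | ⟨_, _, _, _, _, _, _, _, hsq, hpe⟩
        · rw [hsq] at hbody
          rcases hbody with ⟨r, pair, rfl⟩ | ⟨r, rfl⟩
          · exact (hq _ _ (hpe ▸ hph) r).1 _ hm
          · exact (hq _ _ (hpe ▸ hph) r).2 hm
        -- The invocation has just raised the number above that of every old message.
        · omega
        · simp [hpe] at hph
        · simp [hpe] at hph
        · rw [hsq] at hbody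
          rcases hbody with ⟨r, pair, rfl⟩ | ⟨r, rfl⟩
          · exact (hq _ _ hph0 r).1 _ hm
          · exact (hq _ _ hph0 r).2 hm
        · simp [hpe] at hph
      cases h.transit hm with
      | old _ hm => exact hold m hm hc hseq hbody
      | query => simp at hbody
      | propagate q r req τ pair hph' =>
        simp only [Msg.client] at hc
        subst hc
        simp [hph] at hph'
      | reply => simp at hbody
      | ack q r n pair hm' =>
        simp only [Msg.client] at hc hseq
        subst hc hseq
        exact hold _ hm' rfl rfl (.inl ⟨r, pair, rfl⟩)
    exact ⟨fun pair hm => key _ hm rfl rfl (.inl ⟨r, pair, rfl⟩),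
      fun hm => key _ hm rfl rfl (.inr ⟨r, rfl⟩)⟩
  propagate := by
    intro p req τ pair acks hph r pair' hm
    have h1 := hs.query p
    have h2 := hs.propagate p
    generalize hn : (s'.proc p).seq = n at hm
    generalize hM : (⟨p, r, n, .propagate pair'⟩ : Msg P V) = m at hm
    cases h.transit hm with
    | old _ hm => subst hM; rcases h.clientStep p <;> grind
    | propagate q r' req τ pair hph' => grind
    | _ => simp at hM
  transit := by
    intro p req τ pair acks hph r hm
    have h1 := hs.query p
    have h2 := hs.propagate p
    have h3 := hs.transit p
    have h4 := h.pair_mono r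
    generalize hn : (s'.proc p).seq = n at hm
    generalize hM : (⟨r, p, n, .ack⟩ : Msg P V) = m at hm
    cases h.transit hm with
    | old _ hm =>
      subst hM
      refine le_trans ?_ h4
      rcases h.clientStep p <;> grind
    | ack q r' k pair' hm' hle =>
      simp only [Msg.mk.injEq] at hM
      obtain ⟨rfl, rfl, rfl, -⟩ := hM
      -- The ack answers a message of the current phase: if the query phase had ended only in this
      -- step, no propagation with this number could have been in transit before.
      suffices pair' = pair by rwa [← this]
      rcases h.clientStep p <;> grind
    | _ => simp at hM
  acked := by
    intro p req τ pair acks hph r hr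
    have h2 := hs.transit p
    have h3 := hs.acked p
    refine le_trans ?_ (h.pair_mono r)
    rcases h.clientStep p <;> grind

end Invariant

end VMWABD

namespace VMWABD

open VersionedRegister

/-! ### Provenance of the pairs in circulation -/

section Invariant

variable {P V : Type*} [LinearOrder P] {S : Finset P}

/-- All pairs in the system satisfy `G`, and every pair being propagated is computed from one that
satisfies `G`. -/
structure PairInvariant (G : Tag P × V → Prop) (s : State P V) : Prop where
  stored : ∀ r, G (s.proc r).pair
  queryReply : ∀ m ∈ s.net, ∀ pair, m.body = .queryReply pair → G pair
  propagate : ∀ m ∈ s.net, ∀ pair, m.body = .propagate pair → G pair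
  replies : ∀ p req replies, (s.proc p).phase = .query req replies →
    ∀ r pair, replies r = some pair → G pair
  propagation : ∀ p req τ pair acks, (s.proc p).phase = .propagation req τ pair acks →
    G pair ∧ ∃ v, G (τ, v) ∧ pair = newPair p req τ v

theorem newPair_cases (p : P) (req : Request V (Tag P)) (τ : Tag P) (v : V) :
    newPair p req τ v = (τ, v) ∨ ∃ val, req = .write val τ := by
  cases req with
  | read => left; rfl
  | write val ver =>
    by_cases h : ver = τ
    · subst h; exact .inr ⟨val, rfl⟩
    · left; simp [newPair, h]

/-- Pairs are copied from place to place, except at the end of the query phase of a write that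
requested the tag found; `hG` covers just this case. -/
theorem PairInvariant.step {G : Tag P × V → Prop} {s s' : State P V} {a : Action P V}
    (hs : PairInvariant G s) (h : Step S s a s')
    (hG : ∀ p val τ pair, (s'.proc p).phase = .propagation (.write val τ) τ pair ∅ → G pair) :
    PairInvariant G s' := by
  -- This clause comes first because a freshly broadcast pair satisfies `G` by the clause for the
  -- new state.
  have hprop : ∀ p req τ pair acks, (s'.proc p).phase = .propagation req τ pair acks →
      G pair ∧ ∃ v, G (τ, v) ∧ pair = newPair p req τ v := by
    intro p req τ pair acks hph
    have h5 := hs.propagation p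
    rcases h.clientStep p with ⟨_, hsq, hpe⟩ | ⟨_, _, _, hsq, hpe⟩ |
      ⟨req', replies, τ', v, _, hq, _, hmax, hsq, hpe⟩ | ⟨_, _, _, _, _, _, _, hsq, hpe⟩ |
      ⟨_, _, _, _, _, _, hph0, hsq, hpe⟩ | ⟨_, _, _, _, _, _, _, _, hsq, hpe⟩
    · exact h5 _ _ _ _ (hpe ▸ hph)
    · simp [hpe] at hph
    · obtain ⟨⟨r, -, hr⟩, -⟩ := hmax
      have hv := hs.replies p _ _ hq r _ hr
      rw [hph] at hpe
      simp only [Phase.propagation.injEq] at hpe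
      obtain ⟨rfl, rfl, rfl, rfl⟩ := hpe
      refine ⟨?_, v, hv, rfl⟩
      rcases newPair_cases p req τ v with h | ⟨val, rfl⟩
      · rwa [h]
      · exact hG _ _ _ _ hph
    · simp [hpe] at hph
    · simp [hpe] at hph
    · grind
  refine ⟨?_, ?_, ?_, ?_, hprop⟩
  · intro r
    rcases h.pair_cases r with h | ⟨_, _, pair, hm, _, h⟩
    · rw [h]; exact hs.stored r
    · rw [h]; exact hs.propagate _ hm _ rfl
  · intro m hm pair hb
    cases h.transit hm with
    | old _ hm => exact hs.queryReply _ hm _ hb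
    | reply p r n hm' =>
      simp only [Body.queryReply.injEq] at hb
      subst hb
      exact hs.stored r
    | _ => simp at hb
  · intro m hm pair hb
    cases h.transit hm with
    | old _ hm => exact hs.propagate _ hm _ hb
    | propagate p r req τ pair' hph =>
      simp only [Body.propagate.injEq] at hb
      subst hb
      exact (hprop _ _ _ _ _ hph).1
    | _ => simp at hb
  · intro p req replies hph r pair hr
    have h4 := hs.replies p
    have h5 := hs.queryReply
    rcases h.clientStep p with ⟨_, hsq, hpe⟩ | ⟨_, _, _, hsq, hpe⟩ |
      ⟨req', replies, τ', v, _, hq, _, hmax, hsq, hpe⟩ | ⟨_, _, _, _, _, _, _, hsq, hpe⟩ |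
      ⟨_, replies', r', pair', _, hm, hph0, hsq, hpe⟩ | ⟨_, _, _, _, _, _, _, _, hsq, hpe⟩
    · exact h4 _ _ (hpe ▸ hph) _ _ hr
    · grind
    · simp [hpe] at hph
    · simp [hpe] at hph
    · rw [hph] at hpe
      simp only [Phase.query.injEq] at hpe
      obtain ⟨rfl, rfl⟩ := hpe
      by_cases hrr : r = r'
      · subst hrr
        simp only [Function.update_self, Option.some.injEq] at hr
        subst hr
        exact h5 _ hm _ rfl
      · rw [Function.update_of_ne hrr] at hr
        exact h4 _ _ hph0 _ _ hr
    · simp [hpe] at hph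

end Invariant

/-! ### Operations within an execution and the quorum argument -/

section Executions

variable {P V : Type*} [LinearOrder P] {S : Finset P} {τ₀ : Tag P} {v₀ : V}
  (ξ : Execution S τ₀ v₀)

/-- The predicate may depend on the time too; when nothing happens the state stays but the clock
moves, hence the separate `hidle`. -/
theorem Execution.induction_from {I : ℕ → State P V → Prop} {t : ℕ} (h0 : I t (ξ.state t))
    (hidle : ∀ u ≥ t, ∀ s, I u s → ξ.act u = none → I (u + 1) s)
    (hstep : ∀ u ≥ t, I u (ξ.state u) → ∀ a, ξ.act u = some a →
      Step S (ξ.state u) a (ξ.state (u + 1)) → I (u + 1) (ξ.state (u + 1))) :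
    ∀ u ≥ t, I u (ξ.state u) := by
  intro u hu
  induction u, hu using Nat.le_induction with
  | base => exact h0
  | succ u hu ih =>
    rcases ha : ξ.act u with _ | a
    · rw [ξ.idle u ha]; exact hidle u hu _ ih ha
    · exact hstep u hu ih a ha (ξ.step u a ha)

theorem Execution.pair_mono (r : P) {t u : ℕ} (h : t ≤ u) :
    ((ξ.state t).proc r).pair.1 ≤ ((ξ.state u).proc r).pair.1 :=
  ξ.induction_from (I := fun _ s => ((ξ.state t).proc r).pair.1 ≤ (s.proc r).pair.1) le_rfl
    (fun _ _ _ h _ => h) (fun _ _ h _ _ hs => h.trans (hs.pair_mono r)) u h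

theorem Execution.seq_mono (p : P) {t u : ℕ} (h : t ≤ u) :
    ((ξ.state t).proc p).seq ≤ ((ξ.state u).proc p).seq :=
  ξ.induction_from (I := fun _ s => ((ξ.state t).proc p).seq ≤ (s.proc p).seq) le_rfl
    (fun _ _ _ h _ => h) (fun _ _ h _ _ hs => h.trans (hs.seq_mono p)) u h

theorem Execution.ackInvariant (t : ℕ) : AckInvariant (ξ.state t) := by
  refine ξ.induction_from (I := fun _ s => AckInvariant s) (t := 0) ?_
    (fun _ _ _ h _ => h) (fun _ _ h _ _ hs => h.step hs) t t.zero_le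
  rw [ξ.init]
  constructor <;> simp [initial]

theorem Execution.invokes_iff {t : ℕ} {p : P} {i : Request V (Tag P)} :
    Invokes ξ.history t p i ↔ ξ.act t = some (.invoke p i) := by
  unfold Invokes Execution.history
  rcases ξ.act t with _ | a
  · simp
  · cases a <;> simp [Action.event]

theorem Execution.history_eq_res_iff {t : ℕ} {p : P} {r : Response V (Tag P)} :
    ξ.history t = some (.res p r) ↔ ξ.act t = some (.respond p r) := by
  unfold Execution.history
  rcases ξ.act t with _ | a
  · simp
  · cases a <;> simp [Action.event]

/-- The phase is one of an operation with request `req`. -/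
def Phase.InFlight (req : Request V (Tag P)) : Phase P V → Prop
  | .idle => False
  | .query req' _ => req' = req
  | .propagation req' _ _ _ => req' = req

variable {ξ}

theorem Execution.seq_invoke {t : ℕ} {p : P} {req : Request V (Tag P)}
    (ht : ξ.act t = some (.invoke p req)) :
    ((ξ.state t).proc p).phase = .idle ∧
    ((ξ.state (t + 1)).proc p).seq = ((ξ.state t).proc p).seq + 1 ∧
      ((ξ.state (t + 1)).proc p).phase = .query req fun _ => none := by
  rcases (ξ.step t _ ht).clientStep p with ⟨hne, _, _⟩ | _ | _ | _ | _ | _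
  · exact absurd rfl (hne (.inv p req) rfl)
  all_goals simp_all

/-- An operation either has responded or is in flight. -/
theorem Execution.respondsAt_or_inFlight {t : ℕ} {p : P} {req : Request V (Tag P)}
    (ht : ξ.act t = some (.invoke p req)) : ∀ u ≥ t + 1,
      (∃ t' r, t' < u ∧ RespondsAt ξ.history t t' r) ∨
      (((ξ.state u).proc p).seq = ((ξ.state (t + 1)).proc p).seq ∧
        ((ξ.state u).proc p).phase.InFlight req ∧
        ∀ v, t < v → v < u → ∀ e, ξ.history v = some e → e.proc ≠ p) := by
  obtain ⟨-, h1, h2⟩ := Execution.seq_invoke ht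
  refine ξ.induction_from (I := fun u s => (∃ t' r, t' < u ∧ RespondsAt ξ.history t t' r) ∨
      ((s.proc p).seq = ((ξ.state (t + 1)).proc p).seq ∧ (s.proc p).phase.InFlight req ∧
        ∀ v, t < v → v < u → ∀ e, ξ.history v = some e → e.proc ≠ p)) ?_ ?_ ?_
  · refine .inr ⟨rfl, by simp [h2, Phase.InFlight], fun v _ _ => by omega⟩
  · rintro u hu s (⟨t', r, hlt, h⟩ | ⟨hseq, hfl, hno⟩) ha
    · exact .inl ⟨t', r, by omega, h⟩
    · refine .inr ⟨hseq, hfl, fun v hv hvu e he => ?_⟩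
      rcases Nat.lt_succ_iff_lt_or_eq.1 hvu with hv' | rfl
      · exact hno v hv hv' e he
      · simp [Execution.history, ha] at he
  · rintro u hu (⟨t', r, hlt, h⟩ | ⟨hseq, hfl, hno⟩) a ha hs
    · exact .inl ⟨t', r, by omega, h⟩
    · have hext : (∀ e, a.event = some e → e.proc ≠ p) →
          ∀ v, t < v → v < u + 1 → ∀ e, ξ.history v = some e → e.proc ≠ p := by
        intro hne v hv hvu e he
        rcases Nat.lt_succ_iff_lt_or_eq.1 hvu with hv' | rfl
        · exact hno v hv hv' e he
        · simp only [Execution.history, ha, Option.bind_some] at he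
          exact hne e he
      rcases hs.clientStep p with ⟨hne, hsq, hpe⟩ | ⟨_, _, hi, hsq, hpe⟩ |
        ⟨req', replies, τ', v, hact, hq, _, hmax, hsq, hpe⟩ |
        ⟨req', τ', pair, _, hact, hq, _, hsq, hpe⟩ |
        ⟨_, replies', r', pair', hact, hm, hq, hsq, hpe⟩ | ⟨_, _, _, _, _, hact, _, hq, hsq, hpe⟩
      · exact .inr ⟨hsq.trans hseq, hpe ▸ hfl, hext hne⟩
      · simp [hi, Phase.InFlight] at hfl
      · refine .inr ⟨hsq.trans hseq, ?_, hext (by simp [hact, Action.event])⟩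
        rw [hq] at hfl; rw [hpe]; exact hfl
      · refine .inl ⟨u, _, Nat.lt_succ_self u, p, req, ξ.invokes_iff.2 ht, by omega,
          ξ.history_eq_res_iff.2 (hact ▸ ha), hno⟩
      · refine .inr ⟨hsq.trans hseq, ?_, hext (by simp [hact, Action.event])⟩
        rw [hq] at hfl; rw [hpe]; exact hfl
      · refine .inr ⟨hsq.trans hseq, ?_, hext (by simp [hact, Action.event])⟩
        rw [hq] at hfl; rw [hpe]; exact hfl

/-- Attributes a phase to its operation: the request survives until the process becomes idle, and
the number changes only at an invocation. -/
theorem Execution.exists_invoke (ξ : Execution S τ₀ v₀) (p : P) : ∀ u ≥ 0, ∀ req,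
    ((ξ.state u).proc p).phase.InFlight req →
      ∃ t < u, ξ.act t = some (.invoke p req) ∧
        ((ξ.state u).proc p).seq = ((ξ.state (t + 1)).proc p).seq := by
  refine ξ.induction_from (I := fun u s => ∀ req, (s.proc p).phase.InFlight req →
      ∃ t < u, ξ.act t = some (.invoke p req) ∧
        (s.proc p).seq = ((ξ.state (t + 1)).proc p).seq) ?_ ?_ ?_
  · simp [ξ.init, initial, Phase.InFlight]
  · intro u _ s h _ req hfl
    obtain ⟨t, ht, h⟩ := h req hfl
    exact ⟨t, by omega, h⟩
  · intro u _ h a ha hs req hfl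
    rcases hs.clientStep p with ⟨hne, hsq, hpe⟩ | ⟨req', hact, hi, hsq, hpe⟩ |
        ⟨req', replies, τ', v, hact, hq, _, hmax, hsq, hpe⟩ |
        ⟨req', τ', pair, _, hact, hq, _, hsq, hpe⟩ |
        ⟨_, replies', r', pair', hact, hm, hq, hsq, hpe⟩ | ⟨_, _, _, _, _, hact, _, hq, hsq, hpe⟩
    · rw [hpe] at hfl
      obtain ⟨t, ht, h⟩ := h req hfl
      exact ⟨t, by omega, by rwa [hsq]⟩
    · rw [hpe] at hfl
      obtain rfl : req' = req := hfl
      exact ⟨u, by omega, hact ▸ ha, rfl⟩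
    · obtain ⟨t, ht, h⟩ := h req (by rw [hpe] at hfl; rw [hq]; exact hfl)
      exact ⟨t, by omega, by rwa [hsq]⟩
    · rw [hpe] at hfl; exact hfl.elim
    · obtain ⟨t, ht, h⟩ := h req (by rw [hpe] at hfl; rw [hq]; exact hfl)
      exact ⟨t, by omega, by rwa [hsq]⟩
    · obtain ⟨t, ht, h⟩ := h req (by rw [hpe] at hfl; rw [hq]; exact hfl)
      exact ⟨t, by omega, by rwa [hsq]⟩

/-- The operations of one process precede one another in the order of their invocations. -/
theorem Execution.precedes_of_lt {t₁ t₂ : ℕ} {p : P} {i₁ i₂ : Request V (Tag P)}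
    (h₁ : ξ.act t₁ = some (.invoke p i₁)) (h₂ : ξ.act t₂ = some (.invoke p i₂)) (h : t₁ < t₂) :
    Precedes ξ.history t₁ t₂ := by
  rcases Execution.respondsAt_or_inFlight h₁ t₂ h with ⟨t', r, hlt, hr⟩ | ⟨-, hfl, -⟩
  · exact ⟨t', r, hr, hlt⟩
  · rw [(Execution.seq_invoke h₂).1] at hfl
    exact hfl.elim

variable (ξ) in
/-- The operation with request `req` invoked by `p` at step `t` has found the largest tag `τ` in
its query phase and propagates `pair`. -/
def Execution.Proposes (t : ℕ) (p : P) (req : Request V (Tag P)) (τ : Tag P) (pair : Tag P × V) :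
    Prop :=
  ξ.act t = some (.invoke p req) ∧ ∃ u > t, ∃ acks,
    ((ξ.state u).proc p).seq = ((ξ.state (t + 1)).proc p).seq ∧
      ((ξ.state u).proc p).phase = .propagation req τ pair acks

/-- Within the phase only the set of acks changes, and it grows. The first two alternatives mean
that the operation is over. -/
theorem Execution.propagation_stable (ξ : Execution S τ₀ v₀) {u : ℕ} {p : P}
    {req : Request V (Tag P)} {τ : Tag P} {pair : Tag P × V} {acks : Finset P}
    (hu : ((ξ.state u).proc p).phase = .propagation req τ pair acks) : ∀ u' ≥ u,
      ((ξ.state u).proc p).seq < ((ξ.state u').proc p).seq ∨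
      ((ξ.state u').proc p).phase = .idle ∨
      ∃ acks', ((ξ.state u').proc p).phase = .propagation req τ pair acks' ∧ acks ⊆ acks' := by
  refine ξ.induction_from (I := fun _ s => ((ξ.state u).proc p).seq < (s.proc p).seq ∨
      (s.proc p).phase = .idle ∨
      ∃ acks', (s.proc p).phase = .propagation req τ pair acks' ∧ acks ⊆ acks')
    (.inr (.inr ⟨acks, hu, subset_rfl⟩)) (fun _ _ _ h _ => h) ?_
  intro u' hu' h a ha hs
  have hmono := hs.seq_mono p
  have hmono' := ξ.seq_mono p hu'
  rcases h with h | h | ⟨acks', h, hsub⟩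
  · left; omega
  · rcases hs.clientStep p with ⟨hne, hsq, hpe⟩ | ⟨req', hact, hi, hsq, hpe⟩ | _ | _ | _ | _
    · exact .inr (.inl (hpe.trans h))
    · left; omega
    all_goals simp_all
  · rcases hs.clientStep p with ⟨hne, hsq, hpe⟩ | ⟨req', hact, hi, hsq, hpe⟩ |
        ⟨req', replies, τ', v, hact, hq, _, hmax, hsq, hpe⟩ |
        ⟨req', τ', pair, _, hact, hq, _, hsq, hpe⟩ |
        ⟨_, replies', r', pair', hact, hm, hq, hsq, hpe⟩ |
        ⟨_, _, _, acks'', r, hact, _, hq, hsq, hpe⟩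
    · exact .inr (.inr ⟨acks', hpe.trans h, hsub⟩)
    · simp [hi] at h
    · simp [hq] at h
    · exact .inr (.inl hpe)
    · simp [hq] at h
    · rw [hq] at h
      simp only [Phase.propagation.injEq] at h
      obtain ⟨rfl, rfl, rfl, rfl⟩ := h
      exact .inr (.inr ⟨_, hpe, hsub.trans (Finset.subset_insert _ _)⟩)

/-- The two witnessing times carry the same number and a non-idle phase, so stability from the
earlier to the later one leaves only equality of the data. -/
theorem Execution.Proposes.unique {t : ℕ} {p p' : P} {req req' : Request V (Tag P)}
    {τ τ' : Tag P} {pair pair' : Tag P × V} (h : ξ.Proposes t p req τ pair)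
    (h' : ξ.Proposes t p' req' τ' pair') : p = p' ∧ req = req' ∧ τ = τ' ∧ pair = pair' := by
  obtain ⟨ha, u, hu, acks, hseq, hph⟩ := h
  obtain ⟨ha', u', hu', acks', hseq', hph'⟩ := h'
  rw [ha] at ha'
  simp only [Option.some.injEq, Action.invoke.injEq] at ha'
  obtain ⟨rfl, rfl⟩ := ha'
  rcases le_total u u' with hle | hle
  · rcases ξ.propagation_stable hph u' hle with h | h | ⟨_, h, -⟩
    · omega
    · simp [h] at hph'
    · simp_all
  · rcases ξ.propagation_stable hph' u hle with h | h | ⟨_, h, -⟩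
    · omega
    · simp [h] at hph
    · simp_all

variable (ξ) in
/-- The pair is the initial one or that of a successful write. -/
def Execution.Written (pair : Tag P × V) : Prop :=
  pair = (τ₀, v₀) ∨ ∃ t p val τ, ξ.Proposes t p (.write val τ) τ pair

theorem Execution.pairInvariant (ξ : Execution S τ₀ v₀) (t : ℕ) :
    PairInvariant ξ.Written (ξ.state t) := by
  refine ξ.induction_from (I := fun _ s => PairInvariant ξ.Written s) (t := 0) ?_
    (fun _ _ _ h _ => h) ?_ t t.zero_le
  · rw [ξ.init]
    constructor <;> simp [initial, Execution.Written]
  · intro u _ h a ha hs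
    refine h.step hs fun p val τ pair hph => ?_
    obtain ⟨t, htu, ht, hseq⟩ := ξ.exists_invoke p (u + 1) (Nat.zero_le _) (.write val τ)
      (by rw [hph]; rfl)
    exact .inr ⟨t, p, val, τ, ht, u + 1, htu, ∅, hseq, hph⟩

theorem Execution.Proposes.exists_written {t : ℕ} {p : P} {req : Request V (Tag P)}
    {τ : Tag P} {pair : Tag P × V} (h : ξ.Proposes t p req τ pair) :
    ∃ v, ξ.Written (τ, v) ∧ pair = newPair p req τ v := by
  obtain ⟨-, u, -, acks, -, hph⟩ := h
  exact ((ξ.pairInvariant u).propagation p _ _ _ _ hph).2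

/-- If a majority of the replicas store a tag of at least `σ` when an operation is invoked, then
the operation finds a tag of at least `σ`. -/
theorem Execution.Proposes.le_of_majority {t : ℕ} {p : P} {req : Request V (Tag P)}
    {τ σ : Tag P} {pair : Tag P × V} (h : ξ.Proposes t p req τ pair)
    (hσ : IsMajority S {r | σ ≤ ((ξ.state t).proc r).pair.1}) : σ ≤ τ := by
  obtain ⟨ht, u, hu, acks, hseq, hph⟩ := h
  obtain ⟨-, h1, h2⟩ := Execution.seq_invoke ht
  set n := ((ξ.state (t + 1)).proc p).seq with hn
  -- As long as operation `n` is current, its replies, in transit or received, carry tags at least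
  -- as large as those their senders stored at time `t`.
  have key : ∀ u ≥ t + 1, n < ((ξ.state u).proc p).seq ∨ ((ξ.state u).proc p).seq = n ∧
      (∀ r pair, ⟨r, p, n, .queryReply pair⟩ ∈ (ξ.state u).net →
        ((ξ.state t).proc r).pair.1 ≤ pair.1) ∧
      (∀ req replies, ((ξ.state u).proc p).phase = .query req replies →
        ∀ r pair, replies r = some pair → ((ξ.state t).proc r).pair.1 ≤ pair.1) ∧
      (∀ req τ pair acks, ((ξ.state u).proc p).phase = .propagation req τ pair acks → σ ≤ τ) := by
    refine ξ.induction_from (I := fun u s => n < (s.proc p).seq ∨ (s.proc p).seq = n ∧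
      (∀ r (pair : Tag P × V), ⟨r, p, n, .queryReply pair⟩ ∈ s.net →
        ((ξ.state t).proc r).pair.1 ≤ pair.1) ∧
      (∀ req replies, (s.proc p).phase = .query req replies →
        ∀ r pair, replies r = some pair → ((ξ.state t).proc r).pair.1 ≤ pair.1) ∧
      (∀ req τ pair acks, (s.proc p).phase = .propagation req τ pair acks → σ ≤ τ)) ?_
      (fun _ _ _ h _ => h) ?_
    · refine .inr ⟨rfl, ?_, ?_, ?_⟩
      · intro r pair hm
        -- The number `n` is fresh: anything in transit for `p` at time `t` has a smaller one.
        have hle := (ξ.ackInvariant t).seq_le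
        generalize hM : (⟨r, p, n, .queryReply pair⟩ : Msg P V) = m at hm
        cases (ξ.step t _ ht).transit hm with
        | old _ hm =>
          subst hM
          have := hle _ hm
          simp only [Msg.client] at this
          omega
        | reply =>
          simp only [Msg.mk.injEq, Body.queryReply.injEq] at hM
          obtain ⟨rfl, -, -, rfl⟩ := hM
          exact le_rfl
        | _ => simp at hM
      · intro req replies hq r pair hr
        grind
      · simp [h2]
    · intro u hu h a ha hs
      have hmono := hs.seq_mono p
      rcases h with h | ⟨hsn, hmsg, hrep, hprop⟩
      · left; omega
      have hmsg' : ∀ r pair, ⟨r, p, n, .queryReply pair⟩ ∈ (ξ.state (u + 1)).net →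
          ((ξ.state t).proc r).pair.1 ≤ pair.1 := by
        intro r pair hm
        generalize hM : (⟨r, p, n, .queryReply pair⟩ : Msg P V) = m at hm
        cases hs.transit hm with
        | old _ hm => subst hM; exact hmsg _ _ hm
        | reply =>
          simp only [Msg.mk.injEq, Body.queryReply.injEq] at hM
          obtain ⟨rfl, -, -, rfl⟩ := hM
          exact ξ.pair_mono r (by omega)
        | _ => simp at hM
      rcases hs.clientStep p with ⟨hne, hsq, hpe⟩ | ⟨req', hact, hi, hsq, hpe⟩ |
        ⟨req', replies, τ', v, hact, hq, hmaj, hmax, hsq, hpe⟩ |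
        ⟨req', τ', pair, _, hact, hq, _, hsq, hpe⟩ |
        ⟨_, replies', r', pair', hact, hm, hq, hsq, hpe⟩ |
        ⟨_, _, _, acks'', r, hact, _, hq, hsq, hpe⟩
      · exact .inr ⟨hsq.trans hsn, hmsg', by rwa [hpe], by rwa [hpe]⟩
      · left; omega
      · refine .inr ⟨hsq.trans hsn, hmsg', by simp [hpe], ?_⟩
        intro req τ pair acks hph
        rw [hpe] at hph
        simp only [Phase.propagation.injEq] at hph
        obtain ⟨rfl, rfl, rfl, rfl⟩ := hph
        -- The quorum intersection: some replica that stored at least `σ` at time `t` is among the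
        -- repliers.
        obtain ⟨r, hrS, hr, hr'⟩ := hσ.exists_mem_inter hmaj
        obtain ⟨⟨τ'', v''⟩, hrr⟩ := Option.ne_none_iff_exists'.1 hr'
        exact (hr.trans (hrep _ _ hq r _ hrr)).trans (hmax.2 r hrS _ _ hrr)
      · exact .inr ⟨hsq.trans hsn, hmsg', by simp [hpe], by simp [hpe]⟩
      · refine .inr ⟨hsq.trans hsn, hmsg', ?_, by simp [hpe]⟩
        intro req replies hph r pair hr
        rw [hpe] at hph
        simp only [Phase.query.injEq] at hph
        obtain ⟨rfl, rfl⟩ := hph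
        by_cases hrr : r = r'
        · subst hrr
          simp only [Function.update_self, Option.some.injEq] at hr
          subst hr
          exact hmsg _ _ (hsn ▸ hm)
        · rw [Function.update_of_ne hrr] at hr
          exact hrep _ _ hq _ _ hr
      · refine .inr ⟨hsq.trans hsn, hmsg', by simp [hpe], ?_⟩
        intro req τ pair acks hph
        grind
  rcases key u hu with h | ⟨-, -, -, h⟩
  · omega
  · exact h _ _ _ _ hph

/-- A response is computed from the outcome of the query phase, and is given when a majority of
the replicas store the propagated tag or a larger one. -/
theorem Execution.proposes_of_respondsAt {t t' : ℕ} {r : Response V (Tag P)}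
    (h : RespondsAt ξ.history t t' r) : ∃ p req τ pair, ξ.Proposes t p req τ pair ∧
      r = response req τ pair ∧
      IsMajority S {r | pair.1 ≤ ((ξ.state t').proc r).pair.1} := by
  obtain ⟨p, req, hi, hlt, hres, hno⟩ := h
  rw [ξ.invokes_iff] at hi
  have hact := ξ.history_eq_res_iff.1 hres
  rcases Execution.respondsAt_or_inFlight hi t' hlt with ⟨t'', r', hlt', p', i', hi', h1, h2, -⟩ |
    ⟨hseq, hfl, -⟩
  · rw [ξ.invokes_iff, hi] at hi'
    simp only [Option.some.injEq, Action.invoke.injEq] at hi'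
    obtain ⟨rfl, rfl⟩ := hi'
    -- An earlier response would be an event of `p` strictly between the invocation and its matching
    -- response.
    exact absurd rfl (hno t'' h1 hlt' _ h2)
  · rcases (ξ.step t' _ hact).clientStep p with ⟨hne, _, _⟩ | _ | _ |
      ⟨req', τ, pair, acks, hact', hq, hmaj, hsq, hpe⟩ | _ | _
    · exact absurd rfl (hne (.res p r) rfl)
    · simp_all
    · simp_all
    · rw [hq] at hfl
      obtain rfl : req' = req := hfl
      simp only [Action.respond.injEq, true_and] at hact'
      exact ⟨p, req', τ, pair, ⟨hi, t', hlt, acks, hseq, hq⟩, hact',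
        hmaj.mono fun r _ hr => (ξ.ackInvariant t').acked p _ _ _ _ hq r hr⟩
    · simp_all
    · simp_all

/-- An operation finds a tag at least as large as those of the operations that precede it. -/
theorem Execution.Proposes.le_of_precedes {t₁ t₂ : ℕ} {p₁ p₂ : P}
    {req₁ req₂ : Request V (Tag P)} {τ₁ τ₂ : Tag P} {pair₁ pair₂ : Tag P × V}
    (h₁ : ξ.Proposes t₁ p₁ req₁ τ₁ pair₁) (h₂ : ξ.Proposes t₂ p₂ req₂ τ₂ pair₂)
    (h : Precedes ξ.history t₁ t₂) : pair₁.1 ≤ τ₂ := by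
  obtain ⟨t', r, hr, hlt⟩ := h
  obtain ⟨p, req, τ, pair, hp, -, hmaj⟩ := Execution.proposes_of_respondsAt hr
  obtain ⟨-, -, -, rfl⟩ := hp.unique h₁
  -- Monotonicity of stored tags carries the majority from the response of the first operation to
  -- the invocation of the second.
  exact h₂.le_of_majority (hmaj.mono fun r _ hr => le_trans hr (ξ.pair_mono r hlt.le))

end Executions

end VMWABD

/-! ### Chains of revisions -/

namespace VersionedRegister

variable {P V Ver : Type*}

theorem RevisionChain.zero (H : History P V Ver) (ops : Set ℕ)
    (resp : ℕ → Response V Ver) (a : Ver) : RevisionChain H ops resp 0 a a :=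
  ⟨fun _ => a, rfl, rfl, by simp⟩

theorem RevisionChain.snoc {H : History P V Ver} {ops : Set ℕ}
    {resp : ℕ → Response V Ver} {a b c : Ver} {k t : ℕ} (h : RevisionChain H ops resp k a b)
    (hw : SuccWrite H ops resp t b c) : RevisionChain H ops resp (k + 1) a c := by
  obtain ⟨s, h0, hk, hs⟩ := h
  refine ⟨fun i => if i ≤ k then s i else c, by simpa using h0, by simp, fun i hi => ?_⟩
  rcases Nat.lt_succ_iff_lt_or_eq.1 hi with hi | rfl
  · simpa [hi.le, Nat.succ_le_iff.2 hi] using hs i hi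
  · exact ⟨t, by simpa [hk] using hw⟩

end VersionedRegister

namespace VMWABD

open VersionedRegister

/-! ### Safety: the completion, its order and the register properties -/

section Safety

variable {P V : Type*} [LinearOrder P] {S : Finset P} {τ₀ : Tag P} {v₀ : V}
  {ξ : Execution S τ₀ v₀}

theorem lt_toLex_succ (τ : Tag P) (p : P) : τ < toLex ((ofLex τ).1 + 1, p) :=
  Prod.Lex.toLex_lt_toLex.2 (.inl (Nat.lt_succ_self _))

theorem le_newPair (p : P) (req : Request V (Tag P)) (τ : Tag P) (v : V) :
    τ ≤ (newPair p req τ v).1 := by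
  rcases newPair_cases p req τ v with h | ⟨val, rfl⟩
  · rw [h]
  · simpa [newPair] using (lt_toLex_succ τ p).le

theorem Execution.Proposes.le {t : ℕ} {p : P} {req : Request V (Tag P)} {τ : Tag P}
    {pair : Tag P × V} (h : ξ.Proposes t p req τ pair) : τ ≤ pair.1 := by
  obtain ⟨v, -, rfl⟩ := h.exists_written
  exact le_newPair p req τ v

theorem Execution.Proposes.write_eq {t : ℕ} {p : P} {val : V} {τ : Tag P} {pair : Tag P × V}
    (h : ξ.Proposes t p (.write val τ) τ pair) :
    pair = (toLex ((ofLex τ).1 + 1, p), val) := by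
  obtain ⟨v, -, rfl⟩ := h.exists_written
  simp [newPair]

theorem Execution.Proposes.write_lt {t : ℕ} {p : P} {val : V} {τ : Tag P} {pair : Tag P × V}
    (h : ξ.Proposes t p (.write val τ) τ pair) : τ < pair.1 := by
  rw [h.write_eq]
  exact lt_toLex_succ τ p

/-- The identifier in the tag shows that both writes are by one process, so if distinct, one
precedes the other; the later finds at least the earlier tag and returns a strictly larger one. -/
theorem Execution.Proposes.write_unique {t₁ t₂ : ℕ} {p₁ p₂ : P} {v₁ v₂ : V} {τ₁ τ₂ : Tag P}
    {pair₁ pair₂ : Tag P × V} (h₁ : ξ.Proposes t₁ p₁ (.write v₁ τ₁) τ₁ pair₁)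
    (h₂ : ξ.Proposes t₂ p₂ (.write v₂ τ₂) τ₂ pair₂) (h : pair₁.1 = pair₂.1) : t₁ = t₂ := by
  have hp : p₁ = p₂ := by
    rw [h₁.write_eq, h₂.write_eq] at h
    exact (Prod.mk.inj (toLex.injective h)).2
  subst hp
  rcases lt_trichotomy t₁ t₂ with hlt | heq | hlt
  · exact absurd h ((h₁.le_of_precedes h₂
      (Execution.precedes_of_lt h₁.1 h₂.1 hlt)).trans_lt h₂.write_lt).ne
  · exact heq
  · exact absurd h.symm ((h₂.le_of_precedes h₁
      (Execution.precedes_of_lt h₂.1 h₁.1 hlt)).trans_lt h₁.write_lt).ne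

/-- Every written tag is at least the initial one. -/
theorem Execution.Written.initial_le {pair : Tag P × V} (h : ξ.Written pair) : τ₀ ≤ pair.1 := by
  -- `Written` does not record times, so the induction is on the integer of the tag, which is
  -- smaller for the tag that the write found.
  induction hz : (ofLex pair.1).1 using Nat.strong_induction_on generalizing pair with
  | _ z ih =>
    rcases h with rfl | ⟨t, p, val, τ, h⟩
    · exact le_rfl
    · obtain ⟨v, hv, -⟩ := h.exists_written
      refine (ih (ofLex τ).1 ?_ hv rfl).trans h.le
      rw [← hz, h.write_eq]
      exact Nat.lt_succ_self _

variable (ξ)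

/-- The operations that have ended their query phase. -/
def Execution.ops : Set ℕ := {t | ∃ p req τ pair, ξ.Proposes t p req τ pair}

open Classical in
/-- The response that is determined by the outcome of the query phase. -/
noncomputable def Execution.resp (t : ℕ) : Response V (Tag P) :=
  if h : ∃ r, ∃ p req τ pair, ξ.Proposes t p req τ pair ∧ r = response req τ pair then h.choose
  else .read v₀ τ₀

variable {ξ}

theorem Execution.Proposes.resp_eq {t : ℕ} {p : P} {req : Request V (Tag P)} {τ : Tag P}
    {pair : Tag P × V} (h : ξ.Proposes t p req τ pair) : ξ.resp t = response req τ pair := by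
  have hex : ∃ r, ∃ p req τ pair, ξ.Proposes t p req τ pair ∧ r = response req τ pair :=
    ⟨_, p, req, τ, pair, h, rfl⟩
  obtain ⟨p', req', τ', pair', h', hr⟩ := hex.choose_spec
  obtain ⟨rfl, rfl, rfl, rfl⟩ := h.unique h'
  rw [Execution.resp, dif_pos hex, hr]

/-- The flag `chg` says that the requested version is the tag found, so `ver` plays both roles. -/
theorem Execution.succWriteVal_iff {t : ℕ} {v : V} {ver ver' : Tag P} :
    SuccWriteVal ξ.history ξ.ops ξ.resp t v ver ver' ↔
      ∃ p, ξ.Proposes t p (.write v ver) ver (ver', v) := by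
  constructor
  · rintro ⟨⟨p, req, τ, pair, h⟩, ⟨p', hi⟩, hr⟩
    rw [ξ.invokes_iff, h.1] at hi
    simp only [Option.some.injEq, Action.invoke.injEq] at hi
    obtain ⟨rfl, rfl⟩ := hi
    rw [h.resp_eq] at hr
    by_cases hv : ver = τ
    · subst hv
      simp only [response, if_true, Response.write.injEq, and_true] at hr
      obtain ⟨rfl, rfl⟩ := hr
      exact ⟨p, h⟩
    · simp [response, hv] at hr
  · rintro ⟨p, h⟩
    exact ⟨⟨_, _, _, _, h⟩, ⟨p, ξ.invokes_iff.2 h.1⟩, by rw [h.resp_eq]; simp [response]⟩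

theorem Execution.succWrite_iff {t : ℕ} {ver ver' : Tag P} :
    SuccWrite ξ.history ξ.ops ξ.resp t ver ver' ↔
      ∃ p v, ξ.Proposes t p (.write v ver) ver (ver', v) := by
  simp only [SuccWrite, Execution.succWriteVal_iff]
  exact exists_comm

theorem Execution.Proposes.succWrite {t : ℕ} {p : P} {v : V} {ver : Tag P} {pair : Tag P × V}
    (h : ξ.Proposes t p (.write v ver) ver pair) :
    SuccWrite ξ.history ξ.ops ξ.resp t ver pair.1 := by
  refine Execution.succWrite_iff.2 ⟨p, v, ?_⟩
  rw [h.write_eq] at *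
  exact h

theorem Execution.isCompletion : IsCompletion ξ.history ξ.ops ξ.resp where
  invoked := by
    rintro t ⟨p, req, _, _, h⟩
    exact ⟨p, req, ξ.invokes_iff.2 h.1⟩
  complete := by
    intro t t' r h
    obtain ⟨p, req, τ, pair, hp, rfl, -⟩ := Execution.proposes_of_respondsAt h
    exact ⟨⟨_, _, _, _, hp⟩, hp.resp_eq⟩

theorem Execution.wellTyped : WellTyped ξ.history ξ.ops ξ.resp := by
  rintro t ⟨p, req, τ, pair, h⟩ p' i hi
  rw [ξ.invokes_iff, h.1] at hi
  simp only [Option.some.injEq, Action.invoke.injEq] at hi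
  obtain ⟨rfl, rfl⟩ := hi
  rw [h.resp_eq]
  obtain ⟨v, -, rfl⟩ := h.exists_written
  cases req with
  | read => trivial
  | write val ver =>
    by_cases hv : ver = τ
    · subst hv; simp [response, newPair, Request.Admits]
    · simpa [response, newPair, Request.Admits, hv] using Ne.symm hv

/-- The version returned in a response. -/
def responseVersion {V Ver : Type*} : Response V Ver → Ver
  | .read _ ver => ver
  | .write _ ver _ => ver

theorem responseVersion_response (req : Request V (Tag P)) (τ : Tag P) (pair : Tag P × V) :
    responseVersion (response req τ pair) = pair.1 := by
  cases req <;> rfl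

variable (ξ) in
/-- Operations are ordered by the versions that they return, and a successful write comes before
the reads that return its version. -/
def Execution.lt (a b : ℕ) : Prop :=
  responseVersion (ξ.resp a) < responseVersion (ξ.resp b) ∨
    responseVersion (ξ.resp a) = responseVersion (ξ.resp b) ∧
      IsWrite ξ.history ξ.ops ξ.resp a ∧ ¬ IsWrite ξ.history ξ.ops ξ.resp b

theorem Execution.Proposes.version_eq {t : ℕ} {p : P} {req : Request V (Tag P)} {τ : Tag P}
    {pair : Tag P × V} (h : ξ.Proposes t p req τ pair) : responseVersion (ξ.resp t) = pair.1 := by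
  rw [h.resp_eq, responseVersion_response]

theorem Execution.isWrite_iff {t : ℕ} : IsWrite ξ.history ξ.ops ξ.resp t ↔
    ∃ p v ver ver', ξ.Proposes t p (.write v ver) ver (ver', v) := by
  simp only [IsWrite, Execution.succWrite_iff]
  grind

theorem Execution.isAtomic : IsAtomic τ₀ v₀ ξ.history ξ.ops ξ.resp ξ.lt where
  irrefl := by
    rintro a - (h | ⟨-, h, h'⟩)
    · exact lt_irrefl _ h
    · exact h' h
  trans := by
    rintro a - b - c - (h | ⟨h, ha, hb⟩) (h' | ⟨h', hb', hc⟩)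
    · exact .inl (h.trans h')
    · exact .inl (h' ▸ h)
    · exact .inl (h ▸ h')
    · exact absurd hb' hb
  A1 := by
    rintro a ⟨p, req, τ, pair, ha⟩ b ⟨p', req', τ', pair', hb⟩ hpre hlt
    -- The version of `a` is at most the tag found by `b`, so `b` could come before `a` only as a
    -- successful write with the same version; but such a write exceeds the tag it found.
    have hle := ha.le_of_precedes hb hpre
    have hle' := hb.le
    rcases hlt with hlt | ⟨heq, hw, -⟩
    · rw [ha.version_eq, hb.version_eq] at hlt
      exact absurd hlt (not_lt.2 (hle.trans hle'))
    · rw [ha.version_eq, hb.version_eq] at heq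
      obtain ⟨_, _, _, _, hw⟩ := Execution.isWrite_iff.1 hw
      obtain ⟨rfl, rfl, rfl, rfl⟩ := hw.unique hb
      exact absurd heq (hle.trans_lt hb.write_lt).ne'
  A2 := by
    rintro a - b ⟨p, req, τ, pair, hb⟩ ha hne
    rcases lt_trichotomy (responseVersion (ξ.resp a)) (responseVersion (ξ.resp b)) with h | h | h
    · exact .inl (.inl h)
    · refine .inl (.inr ⟨h, ha, fun hb' => hne ?_⟩)
      obtain ⟨_, _, _, _, ha⟩ := Execution.isWrite_iff.1 ha
      obtain ⟨_, _, _, _, hb'⟩ := Execution.isWrite_iff.1 hb'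
      rw [ha.version_eq, hb'.version_eq] at h
      exact ha.write_unique hb' h
    · exact .inr (.inl h)
  A3 := by
    rintro t v ver ⟨⟨p, req, τ, pair, h⟩, hr⟩
    have hver : responseVersion (ξ.resp t) = ver := by
      rcases hr with hr | hr <;> rw [hr] <;> rfl
    have hnw : ¬ IsWrite ξ.history ξ.ops ξ.resp t := by
      rintro ⟨_, _, _, _, _, hw⟩
      rcases hr with hr | hr <;> simp [hr] at hw
    have hwr : ξ.Written (ver, v) := by
      rw [h.resp_eq] at hr
      obtain ⟨v', hv', rfl⟩ := h.exists_written
      cases req with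
      | read =>
        simp only [response, newPair, reduceCtorEq, Response.read.injEq, or_false] at hr
        obtain ⟨rfl, rfl⟩ := hr
        exact hv'
      | write val ver' =>
        by_cases hv : ver' = τ
        · simp [response, hv] at hr
        · simp only [response, newPair, hv, if_false, reduceCtorEq, Response.write.injEq,
            and_true, false_or] at hr
          obtain ⟨rfl, rfl⟩ := hr
          exact hv'
    rcases hwr with heq | ⟨w, p', val, τ', hw⟩
    · simp only [Prod.mk.injEq] at heq
      obtain ⟨rfl, rfl⟩ := heq
      refine .inr ⟨fun w hw hlt => ?_, rfl, rfl⟩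
      obtain ⟨_, _, ver', _, hw⟩ := Execution.isWrite_iff.1 hw
      obtain ⟨v', hv', -⟩ := hw.exists_written
      have h1 := hv'.initial_le.trans_lt hw.write_lt
      rw [← hw.version_eq] at h1
      rcases hlt with hlt | ⟨heq, -⟩
      · exact absurd (h1.trans hlt) (by rw [hver]; exact lt_irrefl _)
      · exact absurd h1 (by rw [heq, hver]; exact lt_irrefl _)
    · have hval : v = val := (Prod.mk.inj hw.write_eq).2
      subst hval
      have hsw : SuccWriteVal ξ.history ξ.ops ξ.resp w v τ' ver :=
        Execution.succWriteVal_iff.2 ⟨p', hw⟩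
      refine .inl ⟨w, τ', hsw, .inr ⟨?_, ⟨_, _, _, hsw⟩, hnw⟩, fun w' hw' hlt => ?_⟩
      · rw [hw.version_eq, hver]
      · rw [or_iff_not_imp_left]
        intro hne
        have hle : responseVersion (ξ.resp w') ≤ ver := by
          rcases hlt with hlt | ⟨heq, -⟩
          · exact hver ▸ hlt.le
          · exact (heq.trans hver).le
        -- A write before the read has version at most `ver`; equality would make it `w`.
        refine .inl (lt_of_le_of_ne (hle.trans hw.version_eq.ge) fun heq => hne ?_)
        obtain ⟨_, _, _, _, hw'⟩ := Execution.isWrite_iff.1 hw'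
        rw [hw'.version_eq, hw.version_eq] at heq
        exact hw'.write_unique hw heq

/-- The tag found by the write is itself written and has a smaller integer; the chain to it is
extended by this write. -/
theorem Execution.Written.exists_chain {pair : Tag P × V} (h : ξ.Written pair) :
    ∃ k, RevisionChain ξ.history ξ.ops ξ.resp k τ₀ pair.1 := by
  induction hz : (ofLex pair.1).1 using Nat.strong_induction_on generalizing pair with
  | _ z ih =>
    rcases h with rfl | ⟨t, p, val, τ, h⟩
    · exact ⟨0, RevisionChain.zero _ _ _ _⟩
    · obtain ⟨v, hv, -⟩ := h.exists_written
      obtain ⟨k, hk⟩ := ih (ofLex τ).1 (by rw [← hz, h.write_eq]; exact Nat.lt_succ_self _) hv rfl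
      exact ⟨k + 1, hk.snoc h.succWrite⟩

theorem Execution.isValid : IsValid τ₀ ξ.history ξ.ops ξ.resp where
  increasing := by
    intro t ver ver' h
    obtain ⟨p, v, h⟩ := Execution.succWrite_iff.1 h
    exact h.write_lt
  unique := by
    intro t₁ t₂ a b ver' ver'' hne h₁ h₂ heq
    obtain ⟨_, _, h₁⟩ := Execution.succWrite_iff.1 h₁
    obtain ⟨_, _, h₂⟩ := Execution.succWrite_iff.1 h₂
    exact hne (h₁.write_unique h₂ heq)
  derived := by
    rintro ver (rfl | ⟨t, ver', h⟩)
    · exact ⟨0, RevisionChain.zero _ _ _ _⟩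
    · obtain ⟨p, v, h⟩ := Execution.succWrite_iff.1 h
      exact Execution.Written.exists_chain (pair := (ver, v)) (.inr ⟨t, p, v, ver', h⟩)

/-- Each revision increases the integer of the tag by one. -/
theorem Execution.fst_of_chain {k : ℕ} {a b : Tag P}
    (h : RevisionChain ξ.history ξ.ops ξ.resp k a b) : (ofLex b).1 = (ofLex a).1 + k := by
  obtain ⟨s, rfl, rfl, hs⟩ := h
  induction k with
  | zero => rfl
  | succ k ih =>
    obtain ⟨t, ht⟩ := hs k (Nat.lt_succ_self k)
    obtain ⟨p, v, ht⟩ := Execution.succWrite_iff.1 ht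
    have := ih fun i hi => hs i (by omega)
    rw [(Prod.mk.inj ht.write_eq).1, ofLex_toLex]
    change (ofLex (s k)).1 + 1 = _
    omega

/-- Consolidation is the quorum argument, continuity the provenance of pairs. Evolution compares
integers alone, since these equal the integer of `ver` plus the number of revisions. -/
theorem Execution.isWeaklyCoverable :
    IsWeaklyCoverable τ₀ ξ.history ξ.ops ξ.resp ξ.lt where
  consolidation := by
    intro t₁ t₂ a verᵢ verⱼ b h₁ h₂ hpre
    obtain ⟨_, _, h₁⟩ := Execution.succWrite_iff.1 h₁
    obtain ⟨_, _, h₂⟩ := Execution.succWrite_iff.1 h₂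
    have hle := h₁.le_of_precedes h₂ hpre
    refine ⟨hle, .inl ?_⟩
    rw [h₁.version_eq, h₂.version_eq]
    exact hle.trans_lt h₂.write_lt
  continuity := by
    intro t₂ ver verᵢ h
    obtain ⟨p, v, h⟩ := Execution.succWrite_iff.1 h
    obtain ⟨v', hv | ⟨t₁, p', val, τ, h₁⟩, -⟩ := h.exists_written
    · exact .inr (Prod.mk.inj hv).1
    · refine .inl ⟨t₁, τ, h₁.succWrite, .inl ?_⟩
      rw [h₁.version_eq, h.version_eq]
      exact h.write_lt
  evolution := by
    intro ver _ ver' _ ver'' _ k l hk hl hkl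
    refine Prod.Lex.lt_iff.2 (.inl ?_)
    rw [Execution.fst_of_chain hk, Execution.fst_of_chain hl]
    omega

end Safety

end VMWABD

namespace VMWABD

open VersionedRegister

/-! ### Termination under fairness -/

section Termination

theorem exists_forall_ge_of_finset {P : Type*} {S : Finset P} (Q : P → ℕ → Prop) (t : ℕ)
    (h : ∀ r ∈ S, ∃ T, ∀ u ≥ T, Q r u) : ∃ T ≥ t, ∀ u ≥ T, ∀ r ∈ S, Q r u := by
  have hev : ∀ᶠ u in Filter.atTop, ∀ r ∈ S, Q r u :=
    (Filter.eventually_all_finset S).2 fun r hr => Filter.eventually_atTop.2 (h r hr)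
  obtain ⟨T, hT⟩ := Filter.eventually_atTop.1 hev
  exact ⟨max t T, le_max_left _ _, fun u hu => hT u (le_trans (le_max_right _ _) hu)⟩

variable {P V : Type*} [LinearOrder P] {S : Finset P} {s s' : State P V}

theorem Step.crashed {a : Action P V} (h : Step S s a s') {p : P} (hp : (s'.proc p).crashed) :
    (s.proc p).crashed ∨ a = .crash p := by
  have hrec : ∀ (st : ProcState P V) m, (receive st m).1.crashed = st.crashed := by
    rintro st ⟨src, dst, seq, body⟩
    cases body <;> simp only [receive] <;> split <;> (try split) <;> rfl
  cases h with
  | invoke q => left; by_cases hq : p = q <;> [subst hq; skip] <;> simp_all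
  | endQuery q => left; by_cases hq : p = q <;> [subst hq; skip] <;> simp_all
  | respond q => left; by_cases hq : p = q <;> [subst hq; skip] <;> simp_all
  | deliver m =>
    left
    by_cases hq : p = m.dst
    · subst hq; simpa [hrec] using hp
    · simpa [hq] using hp
  | crash q =>
    by_cases hq : p = q
    · subst hq; right; rfl
    · left; simpa [hq] using hp

theorem Step.queryReply_mem {p r : P} {n : ℕ} (h : Step S s (.deliver ⟨p, r, n, .query⟩) s') :
    ⟨r, p, n, .queryReply (s.proc r).pair⟩ ∈ s'.net := by
  cases h with
  | deliver _ rest => simp [receive]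

theorem Step.ack_mem {p r : P} {n : ℕ} {pair : Tag P × V}
    (h : Step S s (.deliver ⟨p, r, n, .propagate pair⟩) s') : ⟨r, p, n, .ack⟩ ∈ s'.net := by
  cases h with
  | deliver _ rest => simp [receive]

theorem Step.reply_received {p r : P} {pair : Tag P × V} {req : Request V (Tag P)}
    {replies : P → Option (Tag P × V)}
    (h : Step S s (.deliver ⟨r, p, (s.proc p).seq, .queryReply pair⟩) s')
    (hph : (s.proc p).phase = .query req replies) :
    (s'.proc p).phase = .query req (Function.update replies r (some pair)) := by
  cases h with
  | deliver _ rest => simp [receive, hph]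

theorem Step.ack_received {p r : P} {pair : Tag P × V} {req : Request V (Tag P)} {τ : Tag P}
    {acks : Finset P} (h : Step S s (.deliver ⟨r, p, (s.proc p).seq, .ack⟩) s')
    (hph : (s.proc p).phase = .propagation req τ pair acks) :
    (s'.proc p).phase = .propagation req τ pair (insert r acks) := by
  cases h with
  | deliver _ rest => simp [receive, hph]

theorem Step.query_mem {p r : P} {req : Request V (Tag P)} (h : Step S s (.invoke p req) s')
    (hr : r ∈ S) : ⟨p, r, (s'.proc p).seq, .query⟩ ∈ s'.net := by
  cases h with
  | invoke => simp [broadcast, hr]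

theorem Step.propagate_mem {p r : P} {req : Request V (Tag P)} {τ : Tag P} {pair : Tag P × V}
    {acks : Finset P} (h : Step S s (.endQuery p) s')
    (hph : (s'.proc p).phase = .propagation req τ pair acks) (hr : r ∈ S) :
    ⟨p, r, (s'.proc p).seq, .propagate pair⟩ ∈ s'.net := by
  cases h with
  | endQuery _ req' replies τ' v =>
    simp only [Function.update_self, Phase.propagation.injEq] at hph
    obtain ⟨rfl, rfl, rfl, rfl⟩ := hph
    simp [broadcast, hr]

theorem Step.endQuery_phase {p : P} (h : Step S s (.endQuery p) s') :
    (∃ req replies, (s.proc p).phase = .query req replies) ∧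
      ∃ req τ pair, (s'.proc p).phase = .propagation req τ pair ∅ := by
  cases h with
  | endQuery _ req replies τ v _ hph => exact ⟨⟨req, replies, hph⟩, req, τ, _, by simp; rfl⟩

theorem Step.respond_phase {p : P} {r : Response V (Tag P)} (h : Step S s (.respond p r) s') :
    (∃ req τ pair acks, (s.proc p).phase = .propagation req τ pair acks) ∧
      (s'.proc p).phase = .idle := by
  cases h with
  | respond _ req τ pair acks _ hph => exact ⟨⟨req, τ, pair, acks, hph⟩, by simp⟩

theorem exists_isMaxReply {replies : P → Option (Tag P × V)}
    (h : ∃ r ∈ S, replies r ≠ none) : ∃ τ v, IsMaxReply S replies τ v := by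
  classical
  obtain ⟨r₀, hr₀, h₀⟩ := h
  obtain ⟨⟨τ₁, v₁⟩, h₁⟩ := Option.ne_none_iff_exists'.1 h₀
  obtain ⟨r, hr, hmax⟩ := Finset.exists_max_image {r ∈ S | replies r ≠ none}
    -- `τ₁` is a mere default value, never reached on the filtered set.
    (fun r => ((replies r).map Prod.fst).getD τ₁) ⟨r₀, by simp [hr₀, h₀]⟩
  rw [Finset.mem_filter] at hr
  obtain ⟨⟨τ, v⟩, hτ⟩ := Option.ne_none_iff_exists'.1 hr.2
  refine ⟨τ, v, ⟨r, hr.1, hτ⟩, fun r' hr' τ' v' hτ' => ?_⟩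
  simpa [hτ, hτ'] using hmax r' (by simp [hr', hτ'])

variable {τ₀ : Tag P} {v₀ : V} {ξ : Execution S τ₀ v₀}

theorem Execution.Correct.not_crashed {p : P} (hp : ξ.Correct p) (u : ℕ) :
    ¬ ((ξ.state u).proc p).crashed := by
  refine ξ.induction_from (I := fun _ s => ¬ (s.proc p).crashed) (t := 0) ?_
    (fun _ _ _ h _ => h) (fun u _ h a ha hs hc => ?_) u u.zero_le
  · simp [ξ.init, initial]
  · rcases hs.crashed hc with hc | rfl
    · exact h hc
    · exact hp u ha

/-- Only the set of repliers is tracked, as `Function.update` could overwrite a reply. -/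
theorem Execution.query_stable (ξ : Execution S τ₀ v₀) {u : ℕ} {p : P} {req : Request V (Tag P)}
    {replies : P → Option (Tag P × V)}
    (hu : ((ξ.state u).proc p).phase = .query req replies)
    (hno : ∀ u' ≥ u, ξ.act u' ≠ some (.endQuery p)) : ∀ u' ≥ u,
      ((ξ.state u').proc p).seq = ((ξ.state u).proc p).seq ∧
      ∃ replies', ((ξ.state u').proc p).phase = .query req replies' ∧
        ∀ r, replies r ≠ none → replies' r ≠ none := by
  refine ξ.induction_from (I := fun _ s => (s.proc p).seq = ((ξ.state u).proc p).seq ∧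
      ∃ replies', (s.proc p).phase = .query req replies' ∧
        ∀ r, replies r ≠ none → replies' r ≠ none)
    ⟨rfl, replies, hu, fun _ => id⟩ (fun _ _ _ h _ => h) ?_
  rintro u' hu' ⟨hseq, replies', hq, hrep⟩ a ha hs
  rcases hs.clientStep p with ⟨hne, hsq, hpe⟩ | ⟨req', hact, hi, hsq, hpe⟩ |
      ⟨req', replies, τ', v, hact, _, _, hmax, hsq, hpe⟩ |
      ⟨req', τ', pair, _, hact, hi, _, hsq, hpe⟩ |
      ⟨_, replies', r', pair', hact, hm, hq', hsq, hpe⟩ |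
      ⟨_, _, _, acks'', r, hact, _, hi, hsq, hpe⟩
  · exact ⟨hsq.trans hseq, replies', hpe.trans hq, hrep⟩
  · simp [hi] at hq
  · exact absurd (hact ▸ ha) (hno u' hu')
  · simp [hi] at hq
  · rw [hq'] at hq
    simp only [Phase.query.injEq] at hq
    obtain ⟨rfl, rfl⟩ := hq
    refine ⟨hsq.trans hseq, _, hpe, fun r hr => ?_⟩
    by_cases hrr : r = r'
    · subst hrr; simp
    · rw [Function.update_of_ne hrr]; exact hrep r hr
  · simp [hi] at hq

/-- The query phase of a correct process ends. -/
theorem Execution.Fair.exists_endQuery (hfair : ξ.Fair) (hmaj : IsMajority S {r | ξ.Correct r})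
    {t : ℕ} {p : P} {req : Request V (Tag P)} (ht : ξ.act t = some (.invoke p req))
    (hp : ξ.Correct p) : ∃ u ≥ t + 1, ξ.act u = some (.endQuery p) := by
  by_contra! hno
  obtain ⟨-, -, hph⟩ := Execution.seq_invoke ht
  have hst := ξ.query_stable hph hno
  -- There are finitely many replicas, so one time serves for all the correct ones.
  obtain ⟨T, hTt, hT⟩ := exists_forall_ge_of_finset (S := S) (fun r u => ξ.Correct r →
      ∃ replies, ((ξ.state u).proc p).phase = .query req replies ∧ replies r ≠ none) (t + 1) (by
    intro r hr
    by_cases hc : ξ.Correct r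
    swap
    · exact ⟨0, fun _ _ h => absurd h hc⟩
    obtain ⟨u₁, hu₁, ha₁⟩ := hfair.deliver _ hp hc (t + 1) ((ξ.step t _ ht).query_mem hr)
    obtain ⟨u₂, hu₂, ha₂⟩ := hfair.deliver _ hc hp (u₁ + 1) (ξ.step u₁ _ ha₁).queryReply_mem
    obtain ⟨hseq, replies, hq, -⟩ := hst u₂ (by omega)
    -- The number is still current when the reply arrives, so the reply is not ignored.
    rw [← hseq] at ha₂
    have hq' := (ξ.step u₂ _ ha₂).reply_received hq
    refine ⟨u₂ + 1, fun u hu _ => ?_⟩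
    obtain ⟨-, replies', h, hrep⟩ := ξ.query_stable hq' (fun u' hu' => hno u' (by omega)) u hu
    exact ⟨replies', h, hrep r (by simp)⟩)
  -- From `T` on, ending the query phase is always enabled and responding is not, which refutes
  -- every outcome that fairness allows.
  obtain ⟨u, hu, ⟨a, ha | ⟨r, ha⟩, hact⟩ | hnot⟩ := hfair.localStep p hp T
  · exact hno u (by omega) (ha ▸ hact)
  · obtain ⟨-, replies, hq, -⟩ := hst u (by omega)
    subst ha
    obtain ⟨⟨_, _, _, _, h⟩, -⟩ := (ξ.step u _ hact).respond_phase
    simp [hq] at h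
  · obtain ⟨-, replies, hq, -⟩ := hst u (by omega)
    have hm : IsMajority S {r | replies r ≠ none} := hmaj.mono fun r hr hc => by
      obtain ⟨replies', h, hne⟩ := hT u hu r hr hc
      rw [hq] at h
      simp only [Phase.query.injEq, true_and] at h
      exact h ▸ hne
    obtain ⟨τ, v, hmax⟩ := exists_isMaxReply hm.exists_mem
    exact hnot ⟨_, _, .inl rfl, .endQuery _ p req replies τ v (hp.not_crashed u) hq hm hmax⟩

/-- Without a response the process would never be idle again after its invocation. The query phase
ends, so it would remain in the propagation phase, where the acks of the correct replicas eventually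
enable the response for good. -/
theorem Execution.Fair.isComplete (hfair : ξ.Fair) (hmaj : IsMajority S {r | ξ.Correct r})
    {t : ℕ} {p : P} {req : Request V (Tag P)} (ht : ξ.act t = some (.invoke p req))
    (hp : ξ.Correct p) : IsComplete ξ.history t := by
  by_contra hcon
  have hfl : ∀ u ≥ t + 1, ((ξ.state u).proc p).seq = ((ξ.state (t + 1)).proc p).seq ∧
      ((ξ.state u).proc p).phase ≠ .idle := by
    intro u hu
    rcases Execution.respondsAt_or_inFlight ht u hu with ⟨t', r, -, h⟩ | ⟨hseq, h, -⟩
    · exact absurd ⟨t', r, h⟩ hcon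
    · exact ⟨hseq, fun hi => by rw [hi] at h; exact h⟩
  obtain ⟨u₀, hu₀, ha₀⟩ := hfair.exists_endQuery hmaj ht hp
  have hs₀ := ξ.step u₀ _ ha₀
  obtain ⟨-, req', τ, pair, hph⟩ := hs₀.endQuery_phase
  have hst : ∀ u acks, u ≥ u₀ + 1 →
      ((ξ.state u).proc p).phase = .propagation req' τ pair acks → ∀ u' ≥ u, ∃ acks',
        ((ξ.state u').proc p).phase = .propagation req' τ pair acks' ∧ acks ⊆ acks' := by
    intro u acks hu hph u' hu'
    rcases ξ.propagation_stable hph u' hu' with h | h | h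
    · have h1 := (hfl u (by omega)).1
      have h2 := (hfl u' (by omega)).1
      omega
    · exact absurd h (hfl u' (by omega)).2
    · exact h
  obtain ⟨T, hTt, hT⟩ := exists_forall_ge_of_finset (S := S) (fun r u => ξ.Correct r →
      ∃ acks, ((ξ.state u).proc p).phase = .propagation req' τ pair acks ∧ r ∈ acks) (u₀ + 1) (by
    intro r hr
    by_cases hc : ξ.Correct r
    swap
    · exact ⟨0, fun _ _ h => absurd h hc⟩
    obtain ⟨u₁, hu₁, ha₁⟩ := hfair.deliver _ hp hc (u₀ + 1) (hs₀.propagate_mem hph hr)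
    obtain ⟨u₂, hu₂, ha₂⟩ := hfair.deliver _ hc hp (u₁ + 1) (ξ.step u₁ _ ha₁).ack_mem
    obtain ⟨acks, hq, -⟩ := hst _ _ le_rfl hph u₂ (by omega)
    rw [(hfl (u₀ + 1) (by omega)).1, ← (hfl u₂ (by omega)).1] at ha₂
    have hq' := (ξ.step u₂ _ ha₂).ack_received hq
    refine ⟨u₂ + 1, fun u hu _ => ?_⟩
    obtain ⟨acks', h, hsub⟩ := hst _ _ (by omega) hq' u hu
    exact ⟨acks', h, hsub (Finset.mem_insert_self _ _)⟩)
  obtain ⟨u, hu, ⟨a, ha | ⟨r, ha⟩, hact⟩ | hnot⟩ := hfair.localStep p hp T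
  · obtain ⟨acks, hq, -⟩ := hst _ _ le_rfl hph u (by omega)
    subst ha
    obtain ⟨⟨_, _, h⟩, -⟩ := (ξ.step u _ hact).endQuery_phase
    simp [hq] at h
  · subst ha
    exact (hfl (u + 1) (by omega)).2 (ξ.step u _ hact).respond_phase.2
  · obtain ⟨acks, hq, -⟩ := hst _ _ le_rfl hph u (by omega)
    have hm : IsMajority S (acks : Set P) := hmaj.mono fun r hr hc => by
      obtain ⟨acks', h, hne⟩ := hT u hu r hr hc
      rw [hq] at h
      simp only [Phase.propagation.injEq, true_and] at h
      exact h ▸ hne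
    exact hnot ⟨_, _, .inr ⟨_, rfl⟩, .respond _ p req' τ pair acks (hp.not_crashed u) hq hm⟩

end Termination

end VMWABD

theorem mainTheorem2 {P V : Type*} [LinearOrder P] (S : Finset P) (τ₀ : VMWABD.Tag P) (v₀ : V) :
    (∀ ξ : VMWABD.Execution S τ₀ v₀,
      VersionedRegister.IsWeaklyCoverableAtomic τ₀ v₀ ξ.history) ∧
    (∀ ξ : VMWABD.Execution S τ₀ v₀, ξ.Fair → VMWABD.IsMajority S {r | ξ.Correct r} →
      ∀ t p i, VersionedRegister.Invokes ξ.history t p i → ξ.Correct p →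
        VersionedRegister.IsComplete ξ.history t) :=
  ⟨fun ξ => ⟨ξ.ops, ξ.resp, ξ.lt, VMWABD.Execution.isCompletion, VMWABD.Execution.wellTyped,
    VMWABD.Execution.isAtomic, VMWABD.Execution.isValid, VMWABD.Execution.isWeaklyCoverable⟩,
  fun ξ hfair hmaj _ _ _ hi hp => hfair.isComplete hmaj (ξ.invokes_iff.1 hi) hp⟩
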